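/- \textbf{Setting.} For every security parameter $n$ let $G_1,G_2,G_T$ be groups of prime order $p$ with generators $g_1,g_2$ and a non-degenerate bilinear pairing $e:G_1\times G_2\to G_T$, with polynomial-size representations and polynomial-time operations, and let $H:\{0,1\}^*\to\mathbb Z_p$ and $H_G:\{0,1\}^*\to G_1$ be polynomial-time hash functions. \textbf{Modified Brickell--Li scheme.} \emph{Setup}: choose $h_1,h_2\in G_1$ and $\gamma\in\mathbb Z_p$ uniformly, put $w=g_2^\gamma$, $T_1=e(g_1,g_2)$, $T_2=e(h_1,g_2)$, $T_3=e(h_2,g_2)$, $T_4=e(h_2,w)$; the public key is $pk_I=(h_1,h_2,w,T_1,\dots,T_4)$ and the issuer's secret key is $\gamma$. \emph{Join}: on the issuer's nonce, the user with secret key $f\in\mathbb Z_p^*$ computes $F=h_1^f$, $R=h_1^{r}$ for uniform $r\in\mathbb Z_p$, $c=H(\mathit{nonce}\|F\|R)$ (the original scheme has $c=H(pk_I\|\mathit{nonce}\|F\|R)$; this is the only modification), $s=r+cf$, and sends $u=(F,c,s,\mathit{nonce})$. \emph{Issue}: reject unless $c=H(\mathit{nonce}\|F\|h_1^{s}F^{-c})$;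 otherwise choose $x\in\mathbb Z_p\setminus\{-\gamma\}$ uniformly and output the credential $(A,x)$, $A=(g_1F)^{1/(x+\gamma)}$, which is valid for $f$ iff $e(A,wg_2^x)=e(g_1h_1^f,g_2)$. \emph{Sign} a message $m$ for a basename $dom$: put $B=H_G(dom)$ (uniform in $G_1$ if $dom=\bot$), $K=B^f$, $T=Ah_2^a$, $b=ax$, $R_1=B^{r_f}$, $R_2=e(T,g_2)^{-r_x}T_2^{r_f}T_3^{r_b}T_4^{r_a}$, $c=H(H(pk_I\|B\|K\|T\|R_1\|R_2)\|n_T\|m)$ with uniform $a,r_f,r_x,r_a,r_b\in\mathbb Z_p$ and nonce $n_T$, and output $(B,K,T,c,n_T,s_f,s_x,s_a,s_b)$ with $s_f=r_f+cf$, $s_x=r_x+cx$, $s_a=r_a+ca$, $s_b=r_b+cb$. \emph{Verify}: recompute $R_1=B^{s_f}K^{-c}$ and $R_2=e(T,g_2^{-s_x}w^{-c})T_1^cT_2^{s_f}T_3^{s_b}T_4^{s_a}$, and check $c$, $B=H_G(dom)$ if $dom\ne\bot$, and $K\neq B^{f'}$ for all $f'$ in the revocation list. \emph{Link}: two valid signatures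 are linked iff they have the same $B$ and $K$. \textbf{Updateability.} A DAA scheme is \emph{updateable} if: (1) its setup is a persistent setup, which outputs a persistent key $gpk_1$, followed by an ephemeral setup, which on input $gpk_1$ outputs an ephemeral key $gpk_2$ and the issuer's secret key, with $pk_I=(gpk_1,gpk_2)$; (2) the user's step of the join protocol depends on the public key only through $gpk_1$ and outputs an update $u$, and from $pk_I$, the secret key and $u$ the issuer computes a credential that is valid for the user's key with respect to $pk_I$, for every $pk_I=(gpk_1,gpk_2)$ in which $gpk_2$ comes from an ephemeral setup for the same $gpk_1$; (3) the persistent setup uses only public coins: for every probabilistic polynomial-time (PPT) adversary that is also given these coins, in the user-controlled anonymity experiment or in the user-controlled traceability experiment, there is a PPT adversary without them in the same experiment whose advantage is smaller by at most a negligible amount. \textbf{Theorem.} The modified Brickell--Li scheme is a DAA scheme (all its algorithms are polynomial-time, honestly generated signatures are accepted under the empty revocation list, and two of them by the same user with the same basename other than $\bot$ are linked), and it is updateable, with persistent key $gpk_1=h_1$, whose coins are $h_1$ itself, and with ephemeral key $gpk_2=(h_2,w,T_1,T_2,T_3,T_4)$. In particular the issuer can recompute the users' credentials for a new ephemeral key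 from their stored updates without interaction. -/

import Mathlib

noncomputable section

namespace UpdDAA

open scoped Classical

/-! ## Machine model, polynomial time, encodings -/

/-- Data of the machine model: finite binary trees. -/
inductive Data : Type
  | nil : Data
  | node : Data → Data → Data

namespace Data

/-- Number of vertices of a tree. -/
def size : Data → ℕ
  | nil => 1
  | node a b => size a + size b + 1

/-- Left subtree. -/
def fst : Data → Data
  | nil => nil
  | node a _ => a

/-- Right subtree. -/
def snd : Data → Data
  | nil => nil
  | node _ b => b

/-- The two subtrees are compared; `nil` is false, every other tree is true. -/
def eqTest : Data → Data
  | nil => nil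
  | node a b => if a = b then node nil nil else nil

/-- Unary representation of a natural number. -/
def unary : ℕ → Data
  | 0 => nil
  | n + 1 => node nil (unary n)

theorem unary_injective : Function.Injective unary := by
  intro a
  induction a with
  | zero => intro b h; cases b with
    | zero => rfl
    | succ b => simp [unary] at h
  | succ a ih => intro b h; cases b with
    | zero => simp [unary] at h
    | succ b => simp only [unary, node.injEq, true_and] at h; rw [ih h]

end Data

/-- Programs: a while language on trees with a single variable. -/
inductive Prog : Type
  | zero : Prog
  | id : Prog
  | fst : Prog
  | snd : Prog
  | eq : Prog
  | pair : Prog → Prog → Prog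
  | comp : Prog → Prog → Prog
  | cond : Prog → Prog → Prog → Prog
  | loop : Prog → Prog

/-- `Runs P x y t`: on input `x` the program `P` halts with output `y` after `t` steps. An
elementary operation on a tree costs as many steps as the tree has vertices, plus one (so that a
computation cannot build large trees for free). `comp P Q` runs `Q` first; `loop P` replaces the
current value `x` by the output of `P` as long as the left subtree of `x` is not `nil`. -/
inductive Runs : Prog → Data → Data → ℕ → Prop
  | zero (x : Data) : Runs Prog.zero x Data.nil (x.size + 1)
  | id (x : Data) : Runs Prog.id x x (x.size + 1)
  | fst (x : Data) : Runs Prog.fst x x.fst (x.size + 1)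
  | snd (x : Data) : Runs Prog.snd x x.snd (x.size + 1)
  | eq (x : Data) : Runs Prog.eq x x.eqTest (x.size + 1)
  | pair {P Q : Prog} {x y z : Data} {s t : ℕ} :
      Runs P x y s → Runs Q x z t → Runs (Prog.pair P Q) x (Data.node y z) (s + t + 1)
  | comp {P Q : Prog} {x y z : Data} {s t : ℕ} :
      Runs Q x y s → Runs P y z t → Runs (Prog.comp P Q) x z (s + t + 1)
  | condTrue {C P Q : Prog} {x c y : Data} {s t : ℕ} :
      Runs C x c s → c ≠ Data.nil → Runs P x y t → Runs (Prog.cond C P Q) x y (s + t + 1)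
  | condFalse {C P Q : Prog} {x y : Data} {s t : ℕ} :
      Runs C x Data.nil s → Runs Q x y t → Runs (Prog.cond C P Q) x y (s + t + 1)
  | loopStop {P : Prog} {x : Data} :
      x.fst = Data.nil → Runs (Prog.loop P) x x (x.size + 1)
  | loopStep {P : Prog} {x y z : Data} {s t : ℕ} :
      x.fst ≠ Data.nil → Runs P x y s → Runs (Prog.loop P) y z t →
      Runs (Prog.loop P) x z (x.size + s + t + 1)

/-- An injective representation of the elements of `α` by trees. -/
class Coded (α : Type) where
  enc : α → Data
  inj : Function.Injective enc

/-- `f` is computable in time polynomial in the security parameter (given in unary) and the size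
of the input. -/
def PolyTime {X Y : ℕ → Type} [∀ n, Coded (X n)] [∀ n, Coded (Y n)]
    (f : ∀ n, X n → Y n) : Prop :=
  ∃ (P : Prog) (q : Polynomial ℕ), ∀ (n : ℕ) (x : X n), ∃ t : ℕ,
    t ≤ q.eval (n + (Coded.enc x).size) ∧
      Runs P (Data.node (Data.unary n) (Coded.enc x)) (Coded.enc (f n x)) t

/-- The elements of `X n` have representations of size polynomial in `n`. -/
def PolySize (X : ℕ → Type) [∀ n, Coded (X n)] : Prop :=
  ∃ q : Polynomial ℕ, ∀ (n : ℕ) (x : X n), (Coded.enc x).size ≤ q.eval n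

/-- Negligible functions. -/
def Negligible (ν : ℕ → ℝ) : Prop :=
  Asymptotics.SuperpolynomialDecay Filter.atTop (fun n : ℕ => (n : ℝ)) ν

/-! ### Encodings of the basic data types -/

theorem enc_inj {α : Type} [Coded α] {a b : α} : Coded.enc a = Coded.enc b ↔ a = b :=
  Coded.inj.eq_iff

instance : Coded Data := ⟨fun d => d, fun _ _ h => h⟩

instance : Coded Unit := ⟨fun _ => Data.nil, fun _ _ _ => rfl⟩

instance : Coded Bool :=
  ⟨fun b => if b then Data.node Data.nil Data.nil else Data.nil, by
    intro a b; cases a <;> cases b <;> simp⟩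

instance {α β : Type} [Coded α] [Coded β] : Coded (α × β) :=
  ⟨fun x => Data.node (Coded.enc x.1) (Coded.enc x.2), by
    rintro ⟨a, b⟩ ⟨c, d⟩ h
    simpa [enc_inj] using h⟩

instance {α : Type} [Coded α] : Coded (Option α) :=
  ⟨fun x => match x with
    | none => Data.nil
    | some a => Data.node Data.nil (Coded.enc a), by
    intro a b; cases a <;> cases b <;> simp [enc_inj]⟩

/-- Encoding of lists. -/
def encList {α : Type} [Coded α] : List α → Data
  | [] => Data.nil
  | a :: l => Data.node (Coded.enc a) (encList l)

theorem encList_injective {α : Type} [Coded α] :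
    Function.Injective (encList : List α → Data) := by
  intro l
  induction l with
  | nil => intro m h; cases m with
    | nil => rfl
    | cons b m => simp [encList] at h
  | cons a l ih => intro m h; cases m with
    | nil => simp [encList] at h
    | cons b m =>
      simp only [encList, Data.node.injEq, enc_inj] at h
      rw [h.1, ih h.2]

instance {α : Type} [Coded α] : Coded (List α) := ⟨encList, encList_injective⟩

instance {n : ℕ} : Coded (Fin n → Bool) :=
  ⟨fun v => Coded.enc (List.ofFn v), fun _ _ h => List.ofFn_injective (Coded.inj h)⟩

instance {M : Type} [Monoid M] [Coded M] : Coded Mˣ :=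
  ⟨fun u => Coded.enc (u : M), fun _ _ h => Units.ext (Coded.inj h)⟩

/-! ## DAA schemes -/

/-- Uniform distribution on a finite nonempty type. -/
abbrev unif (α : Type) [Fintype α] [Nonempty α] : PMF α := PMF.uniformOfFintype α

/-- Bit strings. -/
abbrev Str : Type := List Bool

/-- Basenames: `none` is `⊥`. -/
abbrev Basename : Type := Option Str

/-- The algorithms of a DAA scheme, for each value of the security parameter. A probabilistic
algorithm is given as a deterministic function of its inputs and of its random coins, which are
drawn uniformly from a finite set (random bits, scalars, group elements). The join protocol: the issuer sends a random nonce, the user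
answers with `join`, the issuer replies with the output of `issue` (`none`: rejection), and the
user checks the credential with `checkCred`. A user's key and the nonce are uniformly random. -/
structure Scheme where
  (PubKey IssuerKey UserKey Nonce Com Cred Sig : ℕ → Type)
  (SetupCoins JoinCoins IssueCoins SignCoins : ℕ → Type)
  [codePubKey : ∀ n, Coded (PubKey n)]
  [codeIssuerKey : ∀ n, Coded (IssuerKey n)]
  [codeUserKey : ∀ n, Coded (UserKey n)]
  [codeNonce : ∀ n, Coded (Nonce n)]
  [codeCom : ∀ n, Coded (Com n)]
  [codeCred : ∀ n, Coded (Cred n)]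
  [codeSig : ∀ n, Coded (Sig n)]
  [codeSetupCoins : ∀ n, Coded (SetupCoins n)]
  [codeJoinCoins : ∀ n, Coded (JoinCoins n)]
  [codeIssueCoins : ∀ n, Coded (IssueCoins n)]
  [codeSignCoins : ∀ n, Coded (SignCoins n)]
  [finUserKey : ∀ n, Fintype (UserKey n)]
  [finNonce : ∀ n, Fintype (Nonce n)]
  [finSetupCoins : ∀ n, Fintype (SetupCoins n)]
  [finJoinCoins : ∀ n, Fintype (JoinCoins n)]
  [finIssueCoins : ∀ n, Fintype (IssueCoins n)]
  [finSignCoins : ∀ n, Fintype (SignCoins n)]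
  [neUserKey : ∀ n, Nonempty (UserKey n)]
  [neNonce : ∀ n, Nonempty (Nonce n)]
  [neSetupCoins : ∀ n, Nonempty (SetupCoins n)]
  [neJoinCoins : ∀ n, Nonempty (JoinCoins n)]
  [neIssueCoins : ∀ n, Nonempty (IssueCoins n)]
  [neSignCoins : ∀ n, Nonempty (SignCoins n)]
  setup : ∀ n, SetupCoins n → PubKey n × IssuerKey n
  join : ∀ n, PubKey n → UserKey n → Nonce n → JoinCoins n → Com n
  issue : ∀ n, PubKey n → IssuerKey n → Com n → IssueCoins n → Option (Cred n)
  checkCred : ∀ n, PubKey n → UserKey n → Cred n → Bool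
  sign : ∀ n, PubKey n → UserKey n → Cred n → Basename → Str → SignCoins n → Sig n
  /-- Arguments: public key, message, basename, signature, revocation list. -/
  verify : ∀ n, PubKey n → Str → Basename → Sig n → List (UserKey n) → Bool
  /-- Arguments: public key, revocation list, two signatures with their messages and basenames.
  The value is `none` if one of the signatures is invalid. -/
  link : ∀ n, PubKey n → List (UserKey n) → Str × Basename × Sig n → Str × Basename × Sig n →
    Option Bool

attribute [instance] Scheme.codePubKey Scheme.codeIssuerKey Scheme.codeUserKey Scheme.codeNonce
  Scheme.codeCom Scheme.codeCred Scheme.codeSig Scheme.codeSetupCoins Scheme.codeJoinCoins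
  Scheme.codeIssueCoins Scheme.codeSignCoins Scheme.finUserKey Scheme.finNonce
  Scheme.finSetupCoins Scheme.finJoinCoins Scheme.finIssueCoins Scheme.finSignCoins
  Scheme.neUserKey Scheme.neNonce Scheme.neSetupCoins Scheme.neJoinCoins Scheme.neIssueCoins
  Scheme.neSignCoins

/-- All algorithms of the scheme run in polynomial time, on coins, keys and nonces of polynomial
size. -/
structure Scheme.IsPPT (S : Scheme) : Prop where
  setupCoins : PolySize S.SetupCoins
  joinCoins : PolySize S.JoinCoins
  issueCoins : PolySize S.IssueCoins
  signCoins : PolySize S.SignCoins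
  userKey : PolySize S.UserKey
  nonce : PolySize S.Nonce
  setup : PolyTime S.setup
  join : PolyTime (fun n (x : S.PubKey n × S.UserKey n × S.Nonce n × S.JoinCoins n) =>
    S.join n x.1 x.2.1 x.2.2.1 x.2.2.2)
  issue : PolyTime (fun n (x : S.PubKey n × S.IssuerKey n × S.Com n × S.IssueCoins n) =>
    S.issue n x.1 x.2.1 x.2.2.1 x.2.2.2)
  checkCred : PolyTime (fun n (x : S.PubKey n × S.UserKey n × S.Cred n) =>
    S.checkCred n x.1 x.2.1 x.2.2)
  sign : PolyTime
    (fun n (x : S.PubKey n × S.UserKey n × S.Cred n × Basename × Str × S.SignCoins n) =>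
      S.sign n x.1 x.2.1 x.2.2.1 x.2.2.2.1 x.2.2.2.2.1 x.2.2.2.2.2)
  verify : PolyTime
    (fun n (x : S.PubKey n × Str × Basename × S.Sig n × List (S.UserKey n)) =>
      S.verify n x.1 x.2.1 x.2.2.1 x.2.2.2.1 x.2.2.2.2)
  link : PolyTime
    (fun n (x : S.PubKey n × List (S.UserKey n) × (Str × Basename × S.Sig n) ×
        (Str × Basename × S.Sig n)) =>
      S.link n x.1 x.2.1 x.2.2.1 x.2.2.2)

/-- Correctness, for all outcomes of the coins: the signatures of an honest user are accepted
(with empty revocation list), and two of them with the same basename other than `⊥` are linked. -/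
def Scheme.IsCorrect (S : Scheme) : Prop :=
  ∀ (n : ℕ) (r : S.SetupCoins n) (sk : S.UserKey n) (nonce : S.Nonce n) (rj : S.JoinCoins n)
    (ri : S.IssueCoins n),
    let pk := (S.setup n r).1
    let isk := (S.setup n r).2
    ∃ cred, S.issue n pk isk (S.join n pk sk nonce rj) ri = some cred ∧
      ∀ (dom : Basename) (m₀ m₁ : Str) (r₀ r₁ : S.SignCoins n),
        let σ₀ := S.sign n pk sk cred dom m₀ r₀
        let σ₁ := S.sign n pk sk cred dom m₁ r₁
        S.verify n pk m₀ dom σ₀ [] = true ∧ S.verify n pk m₁ dom σ₁ [] = true ∧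
          (dom ≠ none → S.link n pk [] (m₀, dom, σ₀) (m₁, dom, σ₁) = some true)

/-- A DAA scheme: polynomial-time algorithms satisfying correctness. -/
def Scheme.IsDAA (S : Scheme) : Prop := S.IsPPT ∧ S.IsCorrect

/-! ## Interactive adversaries and the two security experiments -/

/-- An interactive probabilistic adversary with inputs `In n`, queries `Q n` and responses `R n`.
Its next query is a function of its whole view: input, random bits, responses so far (oldest
first). The number of random bits and of queries is polynomial in the security parameter. -/
structure Adversary (In Q R : ℕ → Type) where
  tapeLength : Polynomial ℕ
  rounds : Polynomial ℕ
  next : ∀ n, In n × Str × List (R n) → Q n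

/-- The adversary is polynomial-time. -/
def Adversary.IsPPT {In Q R : ℕ → Type} [∀ n, Coded (In n)] [∀ n, Coded (Q n)]
    [∀ n, Coded (R n)] (A : Adversary In Q R) : Prop :=
  PolyTime A.next

/-- `k` rounds of interaction between a query strategy and an oracle with state space `σ`;
the result is the final state. -/
def play {σ Q R : Type} (next : List R → Q) (oracle : σ → Q → PMF (σ × R)) :
    ℕ → σ → List R → PMF σ
  | 0, s, _ => PMF.pure s
  | k + 1, s, view =>
      (oracle s (next view)).bind fun x => play next oracle k x.1 (view ++ [x.2])

/-- Run the adversary on the given input, with fresh random bits. -/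
def Adversary.run {In Q R : ℕ → Type} (A : Adversary In Q R) (n : ℕ) {σ : Type}
    (oracle : σ → Q n → PMF (σ × R n)) (init : σ) (input : In n) : PMF σ :=
  (unif (Fin (A.tapeLength.eval n) → Bool)).bind fun tape =>
    play (fun view => A.next n (input, List.ofFn tape, view)) oracle (A.rounds.eval n) init []

/-- A way of generating the issuer's keys together with auxiliary information `Aux n` that is
handed to the adversary. -/
abbrev Scheme.KeyGen (S : Scheme) (Aux : ℕ → Type) : Type :=
  ∀ n, PMF ((S.PubKey n × S.IssuerKey n) × Aux n)

/-- The distribution of the setup algorithm. -/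
def Scheme.setupDist (S : Scheme) (n : ℕ) : PMF (S.PubKey n × S.IssuerKey n) :=
  (unif (S.SetupCoins n)).map (S.setup n)

/-- The plain setup, without auxiliary information. -/
def Scheme.plainGen (S : Scheme) : S.KeyGen (fun _ => Unit) :=
  fun n => (S.setupDist n).map fun k => (k, ())

/-! ### User-controlled anonymity -/

section Anonymity

variable (S : Scheme) (n : ℕ)

/-- Queries in the anonymity experiment. Joining takes two of them: the adversary, as the issuer,
sends a nonce, and later returns a credential. -/
inductive AnonQuery : Type
  | join (id : Str) (nonce : S.Nonce n)
  | finish (id : Str) (cred : S.Cred n)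
  | sign (id : Str) (dom : Basename) (m : Str)
  | corrupt (id : Str)
  | challenge (id₀ id₁ : Str) (dom : Basename) (m : Str)
  | guess (b : Bool)

/-- Responses in the anonymity experiment. -/
inductive AnonResp : Type
  | bot
  | accepted
  | com (u : S.Com n)
  | key (sk : S.UserKey n)
  | sig (σ : S.Sig n)

/-- What the challenger knows about a signer. -/
structure AnonUser where
  key : S.UserKey n
  cred : Option (S.Cred n)
  corrupted : Bool

/-- State of the challenger: signers, basenames of the answered sign queries, the two signers
and the basename of the challenge, the adversary's final answer. -/
structure AnonState where
  users : Str → Option (AnonUser S n)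
  signed : List (Str × Basename)
  challenge : Option (Str × Str × Basename)
  guess : Option Bool

variable {S n}

/-- The signer `id` is one of the two challenge signers. -/
def AnonState.Challenged (s : AnonState S n) (id : Str) : Prop :=
  ∃ c ∈ s.challenge, id = c.1 ∨ id = c.2.1

/-- The signer `id` may be used in a challenge with basename `dom`. -/
def AnonState.Eligible (s : AnonState S n) (id : Str) (dom : Basename) : Prop :=
  (∀ u ∈ s.users id, u.corrupted = false) ∧ (dom ≠ none → (id, dom) ∉ s.signed)

/-- The signer's key and credential, if the signer has completed the join protocol. -/
def AnonState.credOf (s : AnonState S n) (id : Str) : Option (S.UserKey n × S.Cred n) :=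
  (s.users id).bind fun u => u.cred.map fun c => (u.key, c)

/-- Store new data for the signer `id`. -/
def AnonState.setUser (s : AnonState S n) (id : Str) (u : AnonUser S n) : AnonState S n :=
  { s with users := Function.update s.users id (some u) }

/-- The challenger of the anonymity experiment, with challenge bit `b`. Queries that are not
allowed are answered by `bot`; nothing happens any more after the adversary's final answer. -/
def anonOracle (pk : S.PubKey n) (b : Bool) (s : AnonState S n) (q : AnonQuery S n) :
    PMF (AnonState S n × AnonResp S n) :=
  if s.guess ≠ none then PMF.pure (s, .bot) else
  match q with
  | .join id nonce =>
      if s.users id ≠ none then PMF.pure (s, .bot) else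
      (unif (S.UserKey n)).bind fun sk => (unif (S.JoinCoins n)).map fun r =>
        (s.setUser id ⟨sk, none, false⟩, .com (S.join n pk sk nonce r))
  | .finish id cred =>
      match s.users id with
      | none => PMF.pure (s, .bot)
      | some u =>
          if u.cred = none ∧ S.checkCred n pk u.key cred = true then
            PMF.pure (s.setUser id { u with cred := some cred }, .accepted)
          else PMF.pure (s, .bot)
  | .sign id dom m =>
      match s.credOf id with
      | none => PMF.pure (s, .bot)
      | some (sk, cred) =>
          if dom ≠ none ∧ s.Challenged id ∧ (∃ c ∈ s.challenge, c.2.2 = dom) then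
            PMF.pure (s, .bot)
          else (unif (S.SignCoins n)).map fun r =>
            ({ s with signed := (id, dom) :: s.signed }, .sig (S.sign n pk sk cred dom m r))
  | .corrupt id =>
      match s.users id with
      | none => PMF.pure (s, .bot)
      | some u =>
          if s.Challenged id then PMF.pure (s, .bot)
          else PMF.pure (s.setUser id { u with corrupted := true }, .key u.key)
  | .challenge id₀ id₁ dom m =>
      match s.credOf id₀, s.credOf id₁ with
      | some (sk₀, cred₀), some (sk₁, cred₁) =>
          if s.challenge = none ∧ s.Eligible id₀ dom ∧ s.Eligible id₁ dom then
            (unif (S.SignCoins n)).map fun r =>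
              ({ s with challenge := some (id₀, id₁, dom) },
                .sig (if b then S.sign n pk sk₁ cred₁ dom m r else S.sign n pk sk₀ cred₀ dom m r))
          else PMF.pure (s, .bot)
      | _, _ => PMF.pure (s, .bot)
  | .guess b' => PMF.pure ({ s with guess := some b' }, .bot)

instance : Coded (AnonQuery S n) :=
  ⟨fun q => match q with
    | .join id nonce => Data.node (Data.unary 0) (Coded.enc (id, nonce))
    | .finish id cred => Data.node (Data.unary 1) (Coded.enc (id, cred))
    | .sign id dom m => Data.node (Data.unary 2) (Coded.enc (id, dom, m))
    | .corrupt id => Data.node (Data.unary 3) (Coded.enc id)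
    | .challenge id₀ id₁ dom m => Data.node (Data.unary 4) (Coded.enc (id₀, id₁, dom, m))
    | .guess b => Data.node (Data.unary 5) (Coded.enc b), by
    intro a b; cases a <;> cases b <;> simp [Data.unary_injective.eq_iff, enc_inj]⟩

instance : Coded (AnonResp S n) :=
  ⟨fun q => match q with
    | .bot => Data.node (Data.unary 0) Data.nil
    | .accepted => Data.node (Data.unary 1) Data.nil
    | .com u => Data.node (Data.unary 2) (Coded.enc u)
    | .key sk => Data.node (Data.unary 3) (Coded.enc sk)
    | .sig σ => Data.node (Data.unary 4) (Coded.enc σ), by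
    intro a b; cases a <;> cases b <;> simp [Data.unary_injective.eq_iff, enc_inj]⟩

end Anonymity

/-- Adversaries in the anonymity experiment: the input is the issuer's public and secret key and
the auxiliary information. -/
abbrev AnonAdversary (S : Scheme) (Aux : ℕ → Type) : Type :=
  Adversary (fun n => (S.PubKey n × S.IssuerKey n) × Aux n) (AnonQuery S) (AnonResp S)

/-- The anonymity experiment; the result says whether the adversary's answer is the challenge bit
(no answer counts as the answer `false`). -/
def anonExp (S : Scheme) {Aux : ℕ → Type} (gen : S.KeyGen Aux) (A : AnonAdversary S Aux)
    (n : ℕ) : PMF Bool :=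
  (gen n).bind fun k => (unif Bool).bind fun b =>
    (A.run n (anonOracle k.1.1 b) ⟨fun _ => none, [], none, none⟩ k).map fun s =>
      decide (s.guess.getD false = b)

/-- Advantage over guessing in the anonymity experiment. -/
def anonAdv (S : Scheme) {Aux : ℕ → Type} (gen : S.KeyGen Aux) (A : AnonAdversary S Aux)
    (n : ℕ) : ℝ :=
  |(anonExp S gen A n true).toReal - 1 / 2|

/-! ### User-controlled traceability -/

section Traceability

variable (S : Scheme) (n : ℕ)

/-- Queries in the traceability experiment: the two cases of join queries, sign and corrupt
queries, and the final forgery. -/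
inductive TraceQuery : Type
  | join (id : Str)
  | joinWith (id : Str) (sk : S.UserKey n)
  | sign (id : Str) (dom : Basename) (m : Str)
  | corrupt (id : Str)
  | forge (id : Str) (σ : S.Sig n) (m : Str) (dom : Basename)

/-- Responses in the traceability experiment. -/
inductive TraceResp : Type
  | bot
  | cred (c : S.Cred n)
  | key (sk : S.UserKey n)
  | sig (σ : S.Sig n)

/-- An answered sign query. -/
structure SignRecord where
  id : Str
  dom : Basename
  m : Str
  sig : S.Sig n

/-- State of the challenger: signers, revocation list, answered sign queries, the forgery. -/
structure TraceState where
  users : Str → Option (S.UserKey n × S.Cred n)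
  RL : List (S.UserKey n)
  log : List (SignRecord S n)
  forgery : Option (Str × S.Sig n × Str × Basename)

variable {S n}

/-- The join protocol between honest user and honest issuer. -/
def honestJoin (pk : S.PubKey n) (isk : S.IssuerKey n) (sk : S.UserKey n) :
    PMF (Option (S.Cred n)) :=
  (unif (S.Nonce n)).bind fun nonce => (unif (S.JoinCoins n)).bind fun rj =>
    (unif (S.IssueCoins n)).map fun ri => S.issue n pk isk (S.join n pk sk nonce rj) ri

/-- The challenger of the traceability experiment. -/
def traceOracle (pk : S.PubKey n) (isk : S.IssuerKey n) (s : TraceState S n)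
    (q : TraceQuery S n) : PMF (TraceState S n × TraceResp S n) :=
  if s.forgery ≠ none then PMF.pure (s, .bot) else
  match q with
  | .join id =>
      if s.users id ≠ none then PMF.pure (s, .bot) else
      (unif (S.UserKey n)).bind fun sk => (honestJoin pk isk sk).map fun c =>
        match c with
        | none => (s, .bot)
        | some c => ({ s with users := Function.update s.users id (some (sk, c)) }, .cred c)
  | .joinWith id sk =>
      if s.users id ≠ none then PMF.pure (s, .bot) else
      (honestJoin pk isk sk).map fun c =>
        match c with
        | none => (s, .bot)
        | some c => ({ s with users := Function.update s.users id (some (sk, c)),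
                              RL := sk :: s.RL }, .cred c)
  | .sign id dom m =>
      match s.users id with
      | none => PMF.pure (s, .bot)
      | some (sk, cred) => (unif (S.SignCoins n)).map fun r =>
          ({ s with log := ⟨id, dom, m, S.sign n pk sk cred dom m r⟩ :: s.log },
            .sig (S.sign n pk sk cred dom m r))
  | .corrupt id =>
      match s.users id with
      | none => PMF.pure (s, .bot)
      | some (sk, _) => PMF.pure ({ s with RL := sk :: s.RL }, .key sk)
  | .forge id σ m dom => PMF.pure ({ s with forgery := some (id, σ, m, dom) }, .bot)

/-- The winning condition: a signature that is accepted under the revocation list and is no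
response to a sign query, or, for a basename other than `⊥`, a signature (not a response to
a sign query for a different signer) that is not linked to another signature of the same signer
with the same basename. -/
def TraceState.Wins (pk : S.PubKey n) (s : TraceState S n) : Prop :=
  ∃ id σ m dom, s.forgery = some (id, σ, m, dom) ∧
    ((S.verify n pk m dom σ s.RL = true ∧ ∀ e ∈ s.log, e.sig ≠ σ) ∨
      (dom ≠ none ∧ (∀ e ∈ s.log, e.sig = σ → e.id = id) ∧
        ∃ e ∈ s.log, e.id = id ∧ e.dom = dom ∧ e.sig ≠ σ ∧
          S.link n pk s.RL (m, dom, σ) (e.m, e.dom, e.sig) = some false))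

instance : Coded (TraceQuery S n) :=
  ⟨fun q => match q with
    | .join id => Data.node (Data.unary 0) (Coded.enc id)
    | .joinWith id sk => Data.node (Data.unary 1) (Coded.enc (id, sk))
    | .sign id dom m => Data.node (Data.unary 2) (Coded.enc (id, dom, m))
    | .corrupt id => Data.node (Data.unary 3) (Coded.enc id)
    | .forge id σ m dom => Data.node (Data.unary 4) (Coded.enc (id, σ, m, dom)), by
    intro a b; cases a <;> cases b <;> simp [Data.unary_injective.eq_iff, enc_inj]⟩

instance : Coded (TraceResp S n) :=
  ⟨fun q => match q with
    | .bot => Data.node (Data.unary 0) Data.nil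
    | .cred c => Data.node (Data.unary 1) (Coded.enc c)
    | .key sk => Data.node (Data.unary 2) (Coded.enc sk)
    | .sig σ => Data.node (Data.unary 3) (Coded.enc σ), by
    intro a b; cases a <;> cases b <;> simp [Data.unary_injective.eq_iff, enc_inj]⟩

end Traceability

/-- Adversaries in the traceability experiment: the input is the issuer's public key and the
auxiliary information. -/
abbrev TraceAdversary (S : Scheme) (Aux : ℕ → Type) : Type :=
  Adversary (fun n => S.PubKey n × Aux n) (TraceQuery S) (TraceResp S)

/-- The traceability experiment; the result says whether the adversary wins. -/
def traceExp (S : Scheme) {Aux : ℕ → Type} (gen : S.KeyGen Aux) (A : TraceAdversary S Aux)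
    (n : ℕ) : PMF Bool :=
  (gen n).bind fun k =>
    (A.run n (traceOracle k.1.1 k.1.2) ⟨fun _ => none, [], [], none⟩ (k.1.1, k.2)).map fun s =>
      decide (s.Wins k.1.1)

/-- Advantage in the traceability experiment. -/
def traceAdv (S : Scheme) {Aux : ℕ → Type} (gen : S.KeyGen Aux) (A : TraceAdversary S Aux)
    (n : ℕ) : ℝ :=
  (traceExp S gen A n true).toReal

/-! ## Updateable DAA schemes -/

/-- Candidates for a division of setup and join: a persistent part `setup1` and an ephemeral part
`setup2` of the setup, and the user's step of the join protocol, which only gets the persistent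
key. (The issuer's step is `S.issue`, with inputs the public key, the issuer's secret key and the
user's update.) -/
structure Split (S : Scheme) where
  (PersKey EphKey Coins₁ Coins₂ : ℕ → Type)
  [codePers : ∀ n, Coded (PersKey n)]
  [codeEph : ∀ n, Coded (EphKey n)]
  [codeCoins₁ : ∀ n, Coded (Coins₁ n)]
  [codeCoins₂ : ∀ n, Coded (Coins₂ n)]
  [finCoins₁ : ∀ n, Fintype (Coins₁ n)]
  [finCoins₂ : ∀ n, Fintype (Coins₂ n)]
  [neCoins₁ : ∀ n, Nonempty (Coins₁ n)]
  [neCoins₂ : ∀ n, Nonempty (Coins₂ n)]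
  /-- A public key is a pair of a persistent and an ephemeral key. -/
  pubKey : ∀ n, PersKey n × EphKey n ≃ S.PubKey n
  setup1 : ∀ n, Coins₁ n → PersKey n
  setup2 : ∀ n, PersKey n → Coins₂ n → EphKey n × S.IssuerKey n
  user : ∀ n, PersKey n → S.UserKey n → S.Nonce n → S.JoinCoins n → S.Com n

attribute [instance] Split.codePers Split.codeEph Split.codeCoins₁ Split.codeCoins₂
  Split.finCoins₁ Split.finCoins₂ Split.neCoins₁ Split.neCoins₂

namespace Split

variable {S : Scheme} (D : Split S)

/-- The keys generated by the two setup algorithms on the given coins. -/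
def keys (n : ℕ) (r₁ : D.Coins₁ n) (r₂ : D.Coins₂ n) : S.PubKey n × S.IssuerKey n :=
  (D.pubKey n (D.setup1 n r₁, (D.setup2 n (D.setup1 n r₁) r₂).1),
    (D.setup2 n (D.setup1 n r₁) r₂).2)

/-- The setup in which the coins of `setup1` are handed to the adversary. -/
def leakGen : S.KeyGen D.Coins₁ :=
  fun n => (unif (D.Coins₁ n)).bind fun r₁ => (unif (D.Coins₂ n)).map fun r₂ =>
    (D.keys n r₁ r₂, r₁)

/-- The scheme is updateable by means of the given division. -/
structure IsUpdateable : Prop where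
  coins₁_size : PolySize D.Coins₁
  coins₂_size : PolySize D.Coins₂
  setup1_ppt : PolyTime D.setup1
  setup2_ppt : PolyTime (fun n (x : D.PersKey n × D.Coins₂ n) => D.setup2 n x.1 x.2)
  user_ppt : PolyTime (fun n (x : D.PersKey n × S.UserKey n × S.Nonce n × S.JoinCoins n) =>
    D.user n x.1 x.2.1 x.2.2.1 x.2.2.2)
  /-- The setup is the persistent setup followed by the ephemeral setup. -/
  setup_eq : ∀ n, S.setupDist n =
    (unif (D.Coins₁ n)).bind fun r₁ => (unif (D.Coins₂ n)).map fun r₂ => D.keys n r₁ r₂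
  /-- The user's step of the join protocol only depends on the persistent key. -/
  join_eq : ∀ n (gpk₁ : D.PersKey n) (gpk₂ : D.EphKey n) (sk : S.UserKey n) (nonce : S.Nonce n)
    (r : S.JoinCoins n), S.join n (D.pubKey n (gpk₁, gpk₂)) sk nonce r = D.user n gpk₁ sk nonce r
  /-- From an update made for the persistent key, the issuer computes a valid credential with
  respect to every public key that extends the persistent key by an ephemeral setup. -/
  issue_valid : ∀ n (r₁ : D.Coins₁ n) (sk : S.UserKey n) (nonce : S.Nonce n)
    (rj : S.JoinCoins n) (r₂ : D.Coins₂ n) (ri : S.IssueCoins n),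
    ∃ cred, S.issue n (D.keys n r₁ r₂).1 (D.keys n r₁ r₂).2
        (D.user n (D.setup1 n r₁) sk nonce rj) ri = some cred ∧
      S.checkCred n (D.keys n r₁ r₂).1 sk cred = true
  /-- Handing the coins of the persistent setup to a polynomial-time adversary increases its
  advantage in the anonymity experiment at most negligibly. -/
  anon_public_coins : ∀ A : AnonAdversary S D.Coins₁, A.IsPPT →
    ∃ B : AnonAdversary S (fun _ => Unit), B.IsPPT ∧ ∃ ν : ℕ → ℝ, Negligible ν ∧
      ∀ n, anonAdv S D.leakGen A n ≤ anonAdv S S.plainGen B n + ν n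
  /-- The same for the traceability experiment. -/
  trace_public_coins : ∀ A : TraceAdversary S D.Coins₁, A.IsPPT →
    ∃ B : TraceAdversary S (fun _ => Unit), B.IsPPT ∧ ∃ ν : ℕ → ℝ, Negligible ν ∧
      ∀ n, traceAdv S D.leakGen A n ≤ traceAdv S S.plainGen B n + ν n

end Split

/-! ## The scheme of Brickell and Li -/

/-- A family of bilinear groups of prime order, one for each security parameter, with
representations of their elements. -/
structure BilinearFamily where
  p : ℕ → ℕ
  [prime : ∀ n, Fact (p n).Prime]
  (G₁ G₂ GT : ℕ → Type)
  [group₁ : ∀ n, CommGroup (G₁ n)]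
  [group₂ : ∀ n, CommGroup (G₂ n)]
  [groupT : ∀ n, CommGroup (GT n)]
  [fin₁ : ∀ n, Fintype (G₁ n)]
  [fin₂ : ∀ n, Fintype (G₂ n)]
  [finT : ∀ n, Fintype (GT n)]
  [codeZ : ∀ n, Coded (ZMod (p n))]
  [code₁ : ∀ n, Coded (G₁ n)]
  [code₂ : ∀ n, Coded (G₂ n)]
  [codeT : ∀ n, Coded (GT n)]
  card₁ : ∀ n, Fintype.card (G₁ n) = p n
  card₂ : ∀ n, Fintype.card (G₂ n) = p n
  cardT : ∀ n, Fintype.card (GT n) = p n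
  g₁ : ∀ n, G₁ n
  g₂ : ∀ n, G₂ n
  /-- The pairing. -/
  e : ∀ n, G₁ n →* G₂ n →* GT n
  nondegenerate : ∀ n, e n (g₁ n) (g₂ n) ≠ 1

attribute [instance] BilinearFamily.prime BilinearFamily.group₁ BilinearFamily.group₂
  BilinearFamily.groupT BilinearFamily.fin₁ BilinearFamily.fin₂ BilinearFamily.finT
  BilinearFamily.codeZ BilinearFamily.code₁ BilinearFamily.code₂ BilinearFamily.codeT

/-- Powers with exponents modulo the group order. -/
def pow {p : ℕ} {G : Type} [Monoid G] (x : G) (a : ZMod p) : G := x ^ a.val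

/-- The scalars. -/
abbrev BilinearFamily.Z (B : BilinearFamily) (n : ℕ) : Type := ZMod (B.p n)

/-- The representations have polynomial size, and arithmetic in the scalars, the group operations,
exponentiation and the pairing are computable in polynomial time. -/
structure BilinearFamily.IsEfficient (B : BilinearFamily) : Prop where
  sizeZ : PolySize B.Z
  size₁ : PolySize B.G₁
  size₂ : PolySize B.G₂
  sizeT : PolySize B.GT
  add : PolyTime (fun n (x : B.Z n × B.Z n) => x.1 + x.2)
  neg : PolyTime (fun n (x : B.Z n) => -x)
  mul : PolyTime (fun n (x : B.Z n × B.Z n) => x.1 * x.2)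
  inv : PolyTime (fun n (x : B.Z n) => x⁻¹)
  mul₁ : PolyTime (fun n (x : B.G₁ n × B.G₁ n) => x.1 * x.2)
  mul₂ : PolyTime (fun n (x : B.G₂ n × B.G₂ n) => x.1 * x.2)
  mulT : PolyTime (fun n (x : B.GT n × B.GT n) => x.1 * x.2)
  pow₁ : PolyTime (fun n (x : B.G₁ n × B.Z n) => pow x.1 x.2)
  pow₂ : PolyTime (fun n (x : B.G₂ n × B.Z n) => pow x.1 x.2)
  powT : PolyTime (fun n (x : B.GT n × B.Z n) => pow x.1 x.2)
  gen₁ : PolyTime (fun n (_ : Unit) => B.g₁ n)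
  gen₂ : PolyTime (fun n (_ : Unit) => B.g₂ n)
  pairing : PolyTime (fun n (x : B.G₁ n × B.G₂ n) => B.e n x.1 x.2)

/-- The hash functions: one into the scalars (for challenges; its argument is an arbitrary tree,
tuples of trees taking the place of concatenated strings), one from strings into the first group
(for basenames). -/
structure HashFamily (B : BilinearFamily) where
  hash : ∀ n, Data → B.Z n
  hashG : ∀ n, Str → B.G₁ n

/-- The hash functions are computable in polynomial time. -/
structure HashFamily.IsEfficient {B : BilinearFamily} (H : HashFamily B) : Prop where
  hash : PolyTime H.hash
  hashG : PolyTime H.hashG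

namespace BL

variable {B : BilinearFamily}

/-- The issuer's public key, apart from the groups, their generators and the hash functions. -/
structure PubKey (B : BilinearFamily) (n : ℕ) where
  h₁ : B.G₁ n
  h₂ : B.G₁ n
  w : B.G₂ n
  T₁ : B.GT n
  T₂ : B.GT n
  T₃ : B.GT n
  T₄ : B.GT n

/-- The components of the public key other than `h₁`. -/
structure EphKey (B : BilinearFamily) (n : ℕ) where
  h₂ : B.G₁ n
  w : B.G₂ n
  T₁ : B.GT n
  T₂ : B.GT n
  T₃ : B.GT n
  T₄ : B.GT n

/-- The user's message in the join protocol: the Diffie-Hellman key `F`, the challenge and the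
response of the Schnorr proof of knowledge of the discrete logarithm of `F`, and the nonce. -/
structure Com (B : BilinearFamily) (n : ℕ) where
  F : B.G₁ n
  c : B.Z n
  s : B.Z n
  nonce : Fin n → Bool

/-- A credential. -/
structure Cred (B : BilinearFamily) (n : ℕ) where
  A : B.G₁ n
  x : B.Z n

/-- A signature. -/
structure Sig (B : BilinearFamily) (n : ℕ) where
  base : B.G₁ n
  nym : B.G₁ n
  T : B.G₁ n
  c : B.Z n
  nonce : Fin n → Bool
  sf : B.Z n
  sx : B.Z n
  sa : B.Z n
  sb : B.Z n

instance {n : ℕ} : Coded (PubKey B n) :=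
  ⟨fun k => Coded.enc (k.h₁, k.h₂, k.w, k.T₁, k.T₂, k.T₃, k.T₄), by
    rintro ⟨⟩ ⟨⟩ h; simpa [enc_inj] using h⟩

instance {n : ℕ} : Coded (EphKey B n) :=
  ⟨fun k => Coded.enc (k.h₂, k.w, k.T₁, k.T₂, k.T₃, k.T₄), by
    rintro ⟨⟩ ⟨⟩ h; simpa [enc_inj] using h⟩

instance {n : ℕ} : Coded (Com B n) :=
  ⟨fun u => Coded.enc (u.F, u.c, u.s, u.nonce), by
    rintro ⟨⟩ ⟨⟩ h; simpa [enc_inj] using h⟩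

instance {n : ℕ} : Coded (Cred B n) :=
  ⟨fun k => Coded.enc (k.A, k.x), by
    rintro ⟨⟩ ⟨⟩ h; simpa [enc_inj] using h⟩

instance {n : ℕ} : Coded (Sig B n) :=
  ⟨fun σ => Coded.enc (σ.base, σ.nym, σ.T, σ.c, σ.nonce, σ.sf, σ.sx, σ.sa, σ.sb), by
    rintro ⟨⟩ ⟨⟩ h; simpa [enc_inj] using h⟩

/-- Keys of users: nonzero scalars. -/
abbrev UserKey (B : BilinearFamily) (n : ℕ) : Type := (B.Z n)ˣ

/-- Random choices of a signer: the base (used for basename `⊥`), the nonce, the blinding exponent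
`a`, and the four exponents `rf`, `rx`, `ra`, `rb` of the proof. -/
abbrev SignCoins (B : BilinearFamily) (n : ℕ) : Type :=
  B.G₁ n × (Fin n → Bool) × B.Z n × B.Z n × B.Z n × B.Z n × B.Z n

/-- Setup, with random choices `h₁`, `h₂` and the issuer's secret key `γ`. -/
def setup (n : ℕ) (r : B.G₁ n × B.G₁ n × B.Z n) : PubKey B n × B.Z n :=
  let h₁ := r.1
  let h₂ := r.2.1
  let γ := r.2.2
  let w := pow (B.g₂ n) γ
  (⟨h₁, h₂, w, B.e n (B.g₁ n) (B.g₂ n), B.e n h₁ (B.g₂ n), B.e n h₂ (B.g₂ n), B.e n h₂ w⟩, γ)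

/-- Setup of the remaining components when `h₁` is given, with random choices `h₂` and `γ`. -/
def setup2 (n : ℕ) (h₁ : B.G₁ n) (r : B.G₁ n × B.Z n) : EphKey B n × B.Z n :=
  let h₂ := r.1
  let γ := r.2
  let w := pow (B.g₂ n) γ
  (⟨h₂, w, B.e n (B.g₁ n) (B.g₂ n), B.e n h₁ (B.g₂ n), B.e n h₂ (B.g₂ n), B.e n h₂ w⟩, γ)

variable (H : HashFamily B)

/-- The Fiat-Shamir challenge of the join proof. In the original scheme (`full = true`) the full
public key is hashed as well; the modification (`full = false`) drops it. -/
def joinChallenge (full : Bool) (n : ℕ) (pk : PubKey B n) (nonce : Fin n → Bool) (F R : B.G₁ n) :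
    B.Z n :=
  if full then H.hash n (Coded.enc (pk, nonce, F, R)) else H.hash n (Coded.enc (nonce, F, R))

/-- The user's step of the join protocol, with random choice `r`. -/
def join (full : Bool) (n : ℕ) (pk : PubKey B n) (f : UserKey B n) (nonce : Fin n → Bool)
    (r : B.Z n) : Com B n :=
  let F := pow pk.h₁ (f : B.Z n)
  let R := pow pk.h₁ r
  let c := joinChallenge H full n pk nonce F R
  ⟨F, c, r + c * f, nonce⟩

/-- The user's step of the modified join protocol, as a function of `h₁` alone. -/
def user (n : ℕ) (h₁ : B.G₁ n) (f : UserKey B n) (nonce : Fin n → Bool) (r : B.Z n) : Com B n :=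
  let F := pow h₁ (f : B.Z n)
  let R := pow h₁ r
  let c := H.hash n (Coded.enc (nonce, F, R))
  ⟨F, c, r + c * f, nonce⟩

/-- The issuer's step of the join protocol: check the proof, choose `x` uniformly with
`x + γ ≠ 0` (in terms of the random choice `y = x + γ`), and compute `A`. -/
def issue (full : Bool) (n : ℕ) (pk : PubKey B n) (γ : B.Z n) (u : Com B n) (y : (B.Z n)ˣ) :
    Option (Cred B n) :=
  let R := pow pk.h₁ u.s * pow u.F (-u.c)
  let x : B.Z n := y - γ
  if u.c = joinChallenge H full n pk u.nonce u.F R then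
    some ⟨pow (B.g₁ n * u.F) (x + γ)⁻¹, x⟩
  else none

/-- Validity of a credential for the user's key. -/
def checkCred (n : ℕ) (pk : PubKey B n) (f : UserKey B n) (k : Cred B n) : Bool :=
  decide (B.e n k.A (pk.w * pow (B.g₂ n) k.x) = B.e n (B.g₁ n * pow pk.h₁ (f : B.Z n)) (B.g₂ n))

/-- The Fiat-Shamir challenge of a signature. -/
def signChallenge (n : ℕ) (pk : PubKey B n) (base nym T R₁ : B.G₁ n) (R₂ : B.GT n)
    (nonce : Fin n → Bool) (m : Str) : B.Z n :=
  H.hash n (Coded.enc (H.hash n (Coded.enc (pk, base, nym, T, R₁, R₂)), nonce, m))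

/-- Signing. -/
def sign (n : ℕ) (pk : PubKey B n) (f : UserKey B n) (k : Cred B n) (dom : Basename) (m : Str)
    (r : SignCoins B n) : Sig B n :=
  let (base₀, nonce, a, rf, rx, ra, rb) := r
  let base := match dom with
    | none => base₀
    | some d => H.hashG n d
  let nym := pow base (f : B.Z n)
  let T := k.A * pow pk.h₂ a
  let b := a * k.x
  let R₁ := pow base rf
  let R₂ := pow (B.e n T (B.g₂ n)) (-rx) * pow pk.T₂ rf * pow pk.T₃ rb * pow pk.T₄ ra
  let c := signChallenge H n pk base nym T R₁ R₂ nonce m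
  ⟨base, nym, T, c, nonce, rf + c * f, rx + c * k.x, ra + c * a, rb + c * b⟩

/-- Verification. -/
def verify (n : ℕ) (pk : PubKey B n) (m : Str) (dom : Basename) (σ : Sig B n)
    (RL : List (UserKey B n)) : Bool :=
  let R₁ := pow σ.base σ.sf * pow σ.nym (-σ.c)
  let R₂ := B.e n σ.T (pow (B.g₂ n) (-σ.sx) * pow pk.w (-σ.c)) *
    pow pk.T₁ σ.c * pow pk.T₂ σ.sf * pow pk.T₃ σ.sb * pow pk.T₄ σ.sa
  decide ((∀ d ∈ dom, σ.base = H.hashG n d) ∧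
    σ.c = signChallenge H n pk σ.base σ.nym σ.T R₁ R₂ σ.nonce m ∧
    ∀ f ∈ RL, σ.nym ≠ pow σ.base (f : B.Z n))

/-- Two valid signatures are linked if they have the same base and the same pseudonym. -/
def link (n : ℕ) (pk : PubKey B n) (RL : List (UserKey B n))
    (x y : Str × Basename × Sig B n) : Option Bool :=
  if verify H n pk x.1 x.2.1 x.2.2 RL = true ∧ verify H n pk y.1 y.2.1 y.2.2 RL = true then
    some (decide (x.2.2.base = y.2.2.base ∧ x.2.2.nym = y.2.2.nym))
  else none

end BL

/-- The DAA scheme of Brickell and Li: the original one for `full = true`, and for `full = false`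
the modification in which the full public key is dropped from the challenge of the join proof. -/
def brickellLi (B : BilinearFamily) (H : HashFamily B) (full : Bool) : Scheme where
  PubKey := BL.PubKey B
  IssuerKey := B.Z
  UserKey := BL.UserKey B
  Nonce := fun n => Fin n → Bool
  Com := BL.Com B
  Cred := BL.Cred B
  Sig := BL.Sig B
  SetupCoins := fun n => B.G₁ n × B.G₁ n × B.Z n
  JoinCoins := B.Z
  IssueCoins := fun n => (B.Z n)ˣ
  SignCoins := BL.SignCoins B
  setup := BL.setup
  join := BL.join H full
  issue := BL.issue H full
  checkCred := BL.checkCred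
  sign := BL.sign H
  verify := BL.verify H
  link := BL.link H

/-- The division of the modified scheme: the persistent key is the random group element `h₁`,
which is itself the random choice of the persistent setup; the ephemeral key consists of all other
components of the public key. -/
def brickellLiSplit (B : BilinearFamily) (H : HashFamily B) : Split (brickellLi B H false) where
  PersKey := B.G₁
  EphKey := BL.EphKey B
  Coins₁ := B.G₁
  Coins₂ := fun n => B.G₁ n × B.Z n
  pubKey := fun _ =>
    { toFun := fun k => ⟨k.1, k.2.h₂, k.2.w, k.2.T₁, k.2.T₂, k.2.T₃, k.2.T₄⟩
      invFun := fun k => (k.h₁, ⟨k.h₂, k.w, k.T₁, k.T₂, k.T₃, k.T₄⟩)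
      left_inv := fun _ => rfl
      right_inv := fun _ => rfl }
  setup1 := fun _ h₁ => h₁
  setup2 := BL.setup2
  user := BL.user H

end UpdDAA

end

noncomputable section

namespace UpdDAA

section PolyTime

/-! ## Polynomial-time computations on families of trees -/

/-! The algebra is completeness of Schnorr-type proofs. A group of order `p` is a `ZMod p`-module,
so every verification equation is a linear identity. The recomputed commitment of the join proof is
the user's own (`pow_response`), hence the challenge hashes the same data and issuing never fails.
With `y = x + γ`, the credential satisfies `e(A, w g₂^x) = e(A, g₂^y) = e(A^y, g₂) = e(g₁ F, g₂)`
(`checkCred_issued`), for every ephemeral key with `w = g₂^γ`. For a signature, bilinearity turns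
validity of the credential into a relation among powers of `e(T, w)`, `e(T, g₂)`, `T₁`, ..., `T₄`;
subtracting `c` times this relation from the responses leaves the signer's commitment
(`credential_response`, `verify_commitment`).

Updateability rests on two observations. Without the public key in the join challenge, the user's
step reads `h₁` only. Moreover the coins of the persistent setup are `h₁`, which the public key
displays: an adversary that is given the coins is simulated by one that reads `h₁` off its input.
The two experiments have the same distribution, so the advantages are equal and the negligible loss
is zero (`brickellLi_anonAdv_pull`, `brickellLi_traceAdv_pull`).

Polynomial time is shown by closure properties. Since a step is charged for the size of its tree,
outputs are no larger than running times, and polynomial bounds compose. `PolyRuns` allows arbitrary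
index families, so that a branch may be analysed on the inputs that reach it and a loop body on the
states that occur. The only loop needed is the search through the revocation list
(`PolyTime.list_all`). -/

theorem Data.one_le_size (d : Data) : 1 ≤ d.size := by cases d <;> simp [Data.size]

theorem Data.size_unary (n : ℕ) : (Data.unary n).size = 2 * n + 1 := by
  induction n with
  | zero => rfl
  | succ n ih => simp only [Data.unary, Data.size, ih]; ring

/-- The output of a program is at most as large as its running time. -/
theorem Runs.size_le {P : Prog} {x y : Data} {t : ℕ} (h : Runs P x y t) : y.size ≤ t := by
  induction h with
  | zero x => simp [Data.size]
  | id x => simp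
  | fst x => cases x <;> simp [Data.fst, Data.size]; omega
  | snd x => cases x <;> simp [Data.snd, Data.size]; omega
  | eq x =>
    cases x with
    | nil => simp [Data.eqTest, Data.size]
    | node a b =>
      have ha := a.one_le_size
      have hb := b.one_le_size
      simp only [Data.eqTest]
      split <;> simp only [Data.size] <;> omega
  | pair _ _ h₁ h₂ => simp only [Data.size]; omega
  | comp _ _ h₁ h₂ => omega
  | condTrue _ _ _ h₁ h₂ => omega
  | condFalse _ _ h₁ h₂ => omega
  | loopStop _ => omega
  | loopStep _ _ _ h₁ h₂ => omega

/-- Coefficients in `ℕ` are nonnegative, so a bound on the size can be inserted into a bound on the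
time. -/
theorem eval_mono (q : Polynomial ℕ) : Monotone fun k : ℕ => q.eval k := by
  intro a b hab
  simp only [Polynomial.eval_eq_sum, Polynomial.sum]
  gcongr

/-- Some program transforms `inp i` into `out i`, for every index `i`, in time polynomial in the
size of `inp i`. -/
def PolyRuns {ι : Type} (inp out : ι → Data) : Prop :=
  ∃ (P : Prog) (q : Polynomial ℕ), ∀ i, ∃ t, t ≤ q.eval (inp i).size ∧ Runs P (inp i) (out i) t

namespace PolyRuns

variable {ι κ : Type} {a b c : ι → Data}

theorem id (a : ι → Data) : PolyRuns a a :=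
  ⟨.id, .X + 1, fun i => ⟨_, by simp, .id _⟩⟩

theorem nil (a : ι → Data) : PolyRuns a fun _ => .nil :=
  ⟨.zero, .X + 1, fun i => ⟨_, by simp, .zero _⟩⟩

/-- The intermediate tree is at most as large as the running time of the first program, whence the
term `q.comp p`. -/
theorem comp (hb : PolyRuns b c) (ha : PolyRuns a b) : PolyRuns a c := by
  obtain ⟨P, p, hP⟩ := ha
  obtain ⟨Q, q, hQ⟩ := hb
  refine ⟨.comp Q P, p + q.comp p + 1, fun i => ?_⟩
  obtain ⟨s, hs, hPs⟩ := hP i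
  obtain ⟨t, ht, hQt⟩ := hQ i
  refine ⟨_, ?_, .comp hPs hQt⟩
  have := eval_mono q (hPs.size_le.trans hs)
  simp only [Polynomial.eval_add, Polynomial.eval_comp, Polynomial.eval_one] at this ⊢
  omega

theorem fst (h : PolyRuns a b) : PolyRuns a fun i => (b i).fst :=
  comp ⟨.fst, .X + 1, fun i => ⟨_, by simp, .fst _⟩⟩ h

theorem snd (h : PolyRuns a b) : PolyRuns a fun i => (b i).snd :=
  comp ⟨.snd, .X + 1, fun i => ⟨_, by simp, .snd _⟩⟩ h

theorem eqTest (h : PolyRuns a b) : PolyRuns a fun i => (b i).eqTest :=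
  comp ⟨.eq, .X + 1, fun i => ⟨_, by simp, .eq _⟩⟩ h

theorem pair (hb : PolyRuns a b) (hc : PolyRuns a c) : PolyRuns a fun i => .node (b i) (c i) := by
  obtain ⟨P, p, hP⟩ := hb
  obtain ⟨Q, q, hQ⟩ := hc
  refine ⟨.pair P Q, p + q + 1, fun i => ?_⟩
  obtain ⟨s, hs, hPs⟩ := hP i
  obtain ⟨t, ht, hQt⟩ := hQ i
  refine ⟨_, ?_, .pair hPs hQt⟩
  simp only [Polynomial.eval_add, Polynomial.eval_one]
  omega

/-- The same program and bound serve. This is used to restrict a family to the inputs with a given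
outcome of a test. -/
theorem reindex (h : PolyRuns a b) (φ : κ → ι) :
    PolyRuns (fun k => a (φ k)) fun k => b (φ k) := by
  obtain ⟨P, p, hP⟩ := h
  exact ⟨P, p, fun k => hP (φ k)⟩

/-- Distinction of cases. -/
theorem cond (hc : PolyRuns a c)
    (htrue : PolyRuns (fun i : {i // c i ≠ .nil} => a i) fun i => b i)
    (hfalse : PolyRuns (fun i : {i // c i = .nil} => a i) fun i => b i) : PolyRuns a b := by
  obtain ⟨C, r, hC⟩ := hc
  obtain ⟨P, p, hP⟩ := htrue
  obtain ⟨Q, q, hQ⟩ := hfalse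
  -- Only one branch runs, but the bound must be independent of which one.
  refine ⟨.cond C P Q, r + p + q + 1, fun i => ?_⟩
  obtain ⟨s, hs, hCs⟩ := hC i
  simp only [Polynomial.eval_add, Polynomial.eval_one]
  by_cases h : c i = .nil
  · obtain ⟨t, ht, hQt⟩ := hQ ⟨i, h⟩
    rw [h] at hCs
    exact ⟨_, by dsimp only at ht; omega, .condFalse hCs hQt⟩
  · obtain ⟨t, ht, hPt⟩ := hP ⟨i, h⟩
    exact ⟨_, by dsimp only at ht; omega, .condTrue hCs h hPt⟩

/-- Loops with polynomially many iterations and states of polynomial size. -/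
theorem loop (st : ι → ℕ → Data) (N : ι → ℕ) (r : Polynomial ℕ)
    (hN : ∀ i, N i ≤ r.eval (st i 0).size)
    (hsize : ∀ i, ∀ k ≤ N i, (st i k).size ≤ r.eval (st i 0).size)
    (hgo : ∀ i, ∀ k < N i, (st i k).fst ≠ .nil) (hfin : ∀ i, (st i (N i)).fst = .nil)
    (hbody : PolyRuns (fun x : {x : ι × ℕ // x.2 < N x.1} => st x.1.1 x.1.2)
      fun x => st x.1.1 (x.1.2 + 1)) :
    PolyRuns (fun i => st i 0) fun i => st i (N i) := by
  obtain ⟨P, p, hP⟩ := hbody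
  -- There are at most `r + 1` tests, counting the last one that stops the loop; each round pays for
  -- the test (`r`), the body (`p.comp r`) and one step.
  refine ⟨.loop P, (r + 1) * (r + p.comp r + 1), fun i => ?_⟩
  set M := r.eval (st i 0).size with hM
  -- Here `j` counts the iterations still to come: `Runs.loopStep` peels off the first iteration, so
  -- the induction starts at the final state.
  have key : ∀ j ≤ N i, ∃ t, t ≤ (j + 1) * (M + p.eval M + 1) ∧
      Runs (.loop P) (st i (N i - j)) (st i (N i)) t := by
    intro j
    induction j with
    | zero =>
      intro _
      refine ⟨_, ?_, .loopStop (hfin i)⟩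
      have := hsize i _ le_rfl
      simp only [zero_add, one_mul, Nat.sub_zero]
      omega
    | succ j ih =>
      intro hj
      obtain ⟨t, ht, hrun⟩ := ih (by omega)
      have hlt : N i - (j + 1) < N i := by omega
      obtain ⟨s, hs, hPs⟩ := hP ⟨(i, N i - (j + 1)), hlt⟩
      have hk : N i - (j + 1) + 1 = N i - j := by omega
      simp only [hk] at hPs hs
      refine ⟨_, ?_, .loopStep (hgo i _ hlt) hPs hrun⟩
      have h₁ := hsize i _ hlt.le
      have h₂ : p.eval _ ≤ p.eval M := eval_mono p h₁
      have h₃ : (j + 1 + 1) * (M + p.eval M + 1)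
          = (j + 1) * (M + p.eval M + 1) + (M + p.eval M + 1) := by ring
      omega
  obtain ⟨t, ht, hrun⟩ := key (N i) le_rfl
  rw [Nat.sub_self] at hrun
  refine ⟨t, ht.trans ?_, hrun⟩
  simp only [Polynomial.eval_mul, Polynomial.eval_add, Polynomial.eval_comp, Polynomial.eval_one,
    ← hM]
  exact Nat.mul_le_mul_right _ (Nat.succ_le_succ (hN i))

end PolyRuns

/-! ## Polynomial-time functions -/

variable {X Y Z W : ℕ → Type} [∀ n, Coded (X n)] [∀ n, Coded (Y n)] [∀ n, Coded (Z n)]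
  [∀ n, Coded (W n)]

/-- The input, with the security parameter, as it is presented to programs. -/
def inputOf (X : ℕ → Type) [∀ n, Coded (X n)] (i : Σ n, X n) : Data :=
  .node (.unary i.1) (Coded.enc i.2)

/-- The two notions measure the input by `n + |x|` and by `2n + |x| + 2`, and each is bounded by a
polynomial in the other. -/
theorem polyTime_iff (f : ∀ n, X n → Y n) :
    PolyTime f ↔ PolyRuns (inputOf X) fun i => Coded.enc (f i.1 i.2) := by
  have hsize : ∀ i : Σ n, X n, (inputOf X i).size = 2 * i.1 + (Coded.enc i.2).size + 2 := by
    intro i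
    simp only [inputOf, Data.size, Data.size_unary]
    ring
  constructor
  · rintro ⟨P, q, h⟩
    refine ⟨P, q, fun i => ?_⟩
    obtain ⟨t, ht, hr⟩ := h i.1 i.2
    exact ⟨t, ht.trans (eval_mono q (by rw [hsize]; omega)), hr⟩
  · rintro ⟨P, q, h⟩
    refine ⟨P, q.comp (2 * .X + 2), fun n x => ?_⟩
    obtain ⟨t, ht, hr⟩ := h ⟨n, x⟩
    refine ⟨t, ht.trans ?_, hr⟩
    rw [Polynomial.eval_comp]
    refine eval_mono q ?_
    rw [hsize]
    simp only [Polynomial.eval_add, Polynomial.eval_mul, Polynomial.eval_X, Polynomial.eval_ofNat]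
    omega

namespace PolyTime

theorem comp {g : ∀ n, Y n → Z n} {f : ∀ n, X n → Y n} (hg : PolyTime g) (hf : PolyTime f) :
    PolyTime fun n x => g n (f n x) := by
  rw [polyTime_iff] at *
  -- The second program needs the security parameter as well, so it is kept beside the intermediate
  -- value.
  exact (hg.reindex fun i : Σ n, X n => (⟨i.1, f i.1 i.2⟩ : Σ n, Y n)).comp
    ((PolyRuns.id _).fst.pair hf)

/-- A map that does not change the representation. -/
theorem of_enc_eq {f : ∀ n, X n → Y n} (h : ∀ n x, Coded.enc (f n x) = Coded.enc x) :
    PolyTime f := by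
  rw [polyTime_iff]
  simp only [h]
  exact (PolyRuns.id (inputOf X)).snd

protected theorem id : PolyTime fun n (x : X n) => x := of_enc_eq fun _ _ => rfl

theorem enc : PolyTime fun n (x : X n) => Coded.enc x := of_enc_eq fun _ _ => rfl

theorem prodMk {f : ∀ n, X n → Y n} {g : ∀ n, X n → Z n} (hf : PolyTime f) (hg : PolyTime g) :
    PolyTime fun n x => (f n x, g n x) := by
  rw [polyTime_iff] at *
  exact hf.pair hg

theorem fst {f : ∀ n, X n → Y n × Z n} (hf : PolyTime f) : PolyTime fun n x => (f n x).1 := by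
  rw [polyTime_iff] at *
  exact hf.fst

theorem snd {f : ∀ n, X n → Y n × Z n} (hf : PolyTime f) : PolyTime fun n x => (f n x).2 := by
  rw [polyTime_iff] at *
  exact hf.snd

theorem unit : PolyTime fun n (_ : X n) => () := by
  rw [polyTime_iff]
  exact .nil _

theorem none : PolyTime fun n (_ : X n) => (Option.none : Option (Y n)) := by
  rw [polyTime_iff]
  exact .nil _

theorem some {f : ∀ n, X n → Y n} (hf : PolyTime f) :
    PolyTime fun n x => Option.some (f n x) := by
  rw [polyTime_iff] at *
  exact (PolyRuns.nil _).pair hf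

theorem true : PolyTime fun n (_ : X n) => Bool.true := by
  rw [polyTime_iff]
  exact (PolyRuns.nil _).pair (.nil _)

theorem false : PolyTime fun n (_ : X n) => Bool.false := by
  rw [polyTime_iff]
  exact .nil _

/-- Representations are injective, so comparing trees decides equality, and the two results of
`eqTest` are exactly the codes of the booleans. -/
theorem decide_eq {f g : ∀ n, X n → Y n} (hf : PolyTime f) (hg : PolyTime g)
    [∀ n x, Decidable (f n x = g n x)] : PolyTime fun n x => decide (f n x = g n x) := by
  rw [polyTime_iff] at *
  convert (hf.pair hg).eqTest using 2 with i
  simp only [Data.eqTest, enc_inj]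
  simp only [Coded.enc, decide_eq_true_eq]

theorem bool_cond {c : ∀ n, X n → Bool} {f g : ∀ n, X n → Y n} (hc : PolyTime c)
    (hf : PolyTime f) (hg : PolyTime g) :
    PolyTime fun n x => bif c n x then f n x else g n x := by
  rw [polyTime_iff] at *
  refine .cond hc ?_ ?_
  · convert hf.reindex (Subtype.val : {i // Coded.enc (c i.1 i.2) ≠ Data.nil} → _) using 2 with i
    have hi := i.2
    cases h : c i.1.1 i.1.2
    · simp [h, Coded.enc] at hi
    · rfl
  · convert hg.reindex (Subtype.val : {i // Coded.enc (c i.1 i.2) = Data.nil} → _) using 2 with i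
    have hi := i.2
    cases h : c i.1.1 i.1.2
    · rfl
    · simp [h, Coded.enc] at hi

theorem ite {p : ∀ n, X n → Prop} [∀ n x, Decidable (p n x)] {f g : ∀ n, X n → Y n}
    (hp : PolyTime fun n x => decide (p n x)) (hf : PolyTime f) (hg : PolyTime g) :
    PolyTime fun n x => if p n x then f n x else g n x := by
  simpa only [Bool.cond_decide] using bool_cond hp hf hg

theorem and {b c : ∀ n, X n → Bool} (hb : PolyTime b) (hc : PolyTime c) :
    PolyTime fun n x => b n x && c n x := by
  simpa only [Bool.cond_false_right] using bool_cond hb hc false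

theorem not {b : ∀ n, X n → Bool} (hb : PolyTime b) : PolyTime fun n x => !b n x := by
  simpa using bool_cond hb false true

/-- The code is `nil` precisely for `none`, and otherwise the right subtree is the code of the
value. On the inputs of the second branch the value exists, so `Option.get` may be used there. -/
theorem option_elim {o : ∀ n, X n → Option (Y n)} {f : ∀ n, X n → Z n}
    {g : ∀ n, X n × Y n → Z n} (ho : PolyTime o) (hf : PolyTime f) (hg : PolyTime g) :
    PolyTime fun n x => (o n x).elim (f n x) fun y => g n (x, y) := by
  rw [polyTime_iff] at *
  refine .cond ho ?_ ?_
  · have hsome : ∀ i : {i : Σ n, X n // Coded.enc (o i.1 i.2) ≠ Data.nil},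
        (o i.1.1 i.1.2).isSome := by
      rintro ⟨⟨n, x⟩, h⟩
      dsimp only at h ⊢
      cases h' : o n x
      · simp [h', Coded.enc] at h
      · rfl
    -- The input of `g` is assembled from the security parameter, `x` and the extracted value.
    have hin : PolyRuns (fun i : {i : Σ n, X n // Coded.enc (o i.1 i.2) ≠ Data.nil} =>
        inputOf X i) fun i => inputOf (fun n => X n × Y n)
          ⟨i.1.1, i.1.2, (o i.1.1 i.1.2).get (hsome i)⟩ := by
      convert (PolyRuns.id _).fst.pair
        ((PolyRuns.id _).snd.pair (ho.snd.reindex Subtype.val)) using 2 with i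
      simp only [inputOf, Data.fst, Data.snd]
      obtain ⟨y, hy⟩ := Option.isSome_iff_exists.1 (hsome i)
      simp only [hy, Option.get_some]
      rfl
    convert (hg.reindex fun i : {i : Σ n, X n // Coded.enc (o i.1 i.2) ≠ Data.nil} =>
      (⟨i.1.1, i.1.2, (o i.1.1 i.1.2).get (hsome i)⟩ : Σ n, X n × Y n)).comp hin using 2 with i
    obtain ⟨y, hy⟩ := Option.isSome_iff_exists.1 (hsome i)
    simp only [hy, Option.elim_some, Option.get_some]
  · convert hf.reindex (Subtype.val : {i // Coded.enc (o i.1 i.2) = Data.nil} → _) using 2 with i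
    have hi := i.2
    cases h : o i.1.1 i.1.2
    · rfl
    · simp [h, Coded.enc] at hi

theorem _root_.UpdDAA.enc_list_drop_size_le {α : Type} [Coded α] (l : List α) (k : ℕ) :
    (Coded.enc (l.drop k)).size ≤ (Coded.enc l).size := by
  induction k generalizing l with
  | zero => rfl
  | succ k ih =>
    cases l with
    | nil => rfl
    | cons a l =>
      refine (ih l).trans ?_
      change (encList l).size ≤ (Data.node (Coded.enc a) (encList l)).size
      simp only [Data.size]
      omega

theorem _root_.UpdDAA.length_le_enc_size {α : Type} [Coded α] (l : List α) :
    l.length ≤ (Coded.enc l).size := by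
  induction l with
  | nil => simp
  | cons a l ih =>
    change l.length + 1 ≤ (Coded.enc a).size + (Coded.enc l).size + 1
    omega

/-- Testing all members of a list. -/
theorem list_all {l : ∀ n, X n → List (Y n)} {b : ∀ n, X n × Y n → Bool} (hl : PolyTime l)
    (hb : PolyTime b) : PolyTime fun n x => (l n x).all fun y => b n (x, y) := by
  rw [polyTime_iff] at *
  -- The loop state holds the untested part of the list, the conjunction so far, and the original
  -- input. The list is on the left, so the loop stops when it is exhausted.
  let st : (Σ n, X n) → ℕ → Data := fun i k =>
    .node (Coded.enc ((l i.1 i.2).drop k))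
      (.node (Coded.enc (((l i.1 i.2).take k).all fun y => b i.1 (i.2, y))) (inputOf X i))
  have hbool : ∀ b : Bool, (Coded.enc b).size ≤ 3 := by decide
  suffices h : PolyRuns (fun i => st i 0) fun i => st i (l i.1 i.2).length by
    have h₀ : PolyRuns (inputOf X) fun i => st i 0 :=
      hl.pair (.pair (.pair (.nil _) (.nil _)) (.id _))
    convert (h.comp h₀).snd.fst using 2 with i
    simp [st, Data.fst, Data.snd]
  -- The list only shrinks and the input is unchanged; the summand 3 pays for the code of the
  -- boolean.
  refine .loop st (fun i => (l i.1 i.2).length) (.X + 3) (fun i => ?_) (fun i k _ => ?_)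
    (fun i k hk => ?_) (fun i => ?_) ?_
  · have := length_le_enc_size (l i.1 i.2)
    simp only [st, Data.size, List.drop_zero, Polynomial.eval_add, Polynomial.eval_X,
      Polynomial.eval_ofNat]
    omega
  · have := enc_list_drop_size_le (l i.1 i.2) k
    have := hbool (((l i.1 i.2).take k).all fun y => b i.1 (i.2, y))
    simp only [st, Data.size, List.drop_zero, Polynomial.eval_add, Polynomial.eval_X,
      Polynomial.eval_ofNat]
    omega
  · simp only [st, Data.fst, List.drop_eq_getElem_cons hk]
    simp [Coded.enc, encList]
  · simp [st, Data.fst, Coded.enc, encList]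
  -- The loop body is analysed for an arbitrary head, tail and accumulator, and then specialised to
  -- the states that occur.
  · let J := Σ n, (X n × Y n) × List (Y n) × Bool
    let src : J → Data := fun j => .node (Coded.enc (j.2.1.2 :: j.2.2.1))
      (.node (Coded.enc j.2.2.2) (inputOf X ⟨j.1, j.2.1.1⟩))
    have hb' : PolyRuns src fun j => Coded.enc (b j.1 j.2.1) :=
      (hb.reindex fun j : J => (⟨j.1, j.2.1⟩ : Σ n, X n × Y n)).comp
        ((PolyRuns.id src).snd.snd.fst.pair ((PolyRuns.id src).snd.snd.snd.pair
          (PolyRuns.id src).fst.fst))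
    have hand : PolyRuns src fun j => Coded.enc (j.2.2.2 && b j.1 j.2.1) := by
      refine .cond (PolyRuns.id src).snd.fst ?_ ?_
      · convert hb'.reindex Subtype.val using 2 with j
        have hj := j.2
        cases h : j.1.2.2.2
        · simp [src, h, Coded.enc, Data.fst, Data.snd] at hj
        · rfl
      · convert PolyRuns.nil _ using 2 with j
        have hj := j.2
        cases h : j.1.2.2.2
        · rfl
        · simp [src, h, Coded.enc, Data.fst, Data.snd] at hj
    have hstep : PolyRuns src fun j => .node (Coded.enc j.2.2.1)
        (.node (Coded.enc (j.2.2.2 && b j.1 j.2.1)) (inputOf X ⟨j.1, j.2.1.1⟩)) :=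
      (PolyRuns.id src).fst.snd.pair (hand.pair (PolyRuns.id src).snd.snd)
    convert hstep.reindex fun x : {x : (Σ n, X n) × ℕ // x.2 < (l x.1.1 x.1.2).length} =>
      (⟨x.1.1.1, (x.1.1.2, (l x.1.1.1 x.1.1.2)[x.1.2]'x.2), (l x.1.1.1 x.1.1.2).drop (x.1.2 + 1),
        ((l x.1.1.1 x.1.1.2).take x.1.2).all fun y => b x.1.1.1 (x.1.1.2, y)⟩ : J) using 2
      with x x
    · simp only [st, src, List.drop_eq_getElem_cons x.2]
    · have hx := x.2
      simp only [st, List.take_add_one, List.all_append, List.getElem?_eq_getElem hx]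
      simp

end PolyTime

end PolyTime

open scoped Classical

/-! ## Powers with exponents modulo the group order -/

section Pow

variable {p : ℕ} {G : Type} [CommGroup G] [Fintype G]

/-- A commutative group of order `p`, written additively, is a module over `ZMod p`. -/
abbrev zmodModule (hG : Fintype.card G = p) : Module (ZMod p) (Additive G) :=
  AddCommGroup.zmodModule fun x => by
    rw [← hG]
    exact congrArg Additive.ofMul (pow_card_eq_one (x := x.toMul))

/-- Translates powers into scalar multiples, after which identities between powers are left to
`module`. -/
theorem ofMul_pow_eq_smul [NeZero p] (hG : Fintype.card G = p) (x : G) (a : ZMod p) :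
    letI := zmodModule hG
    Additive.ofMul (pow x a) = a • Additive.ofMul x := by
  let := zmodModule hG
  conv_rhs => rw [← ZMod.natCast_zmod_val a, Nat.cast_smul_eq_nsmul]
  rfl

/-- Completeness of Schnorr's proof: `c * f` in the response cancels against the power `-c` of
`x^f`. It serves both the join proof and `R₁` of a signature. -/
theorem pow_response [NeZero p] (hG : Fintype.card G = p) (x : G) (r c f : ZMod p) :
    pow x (r + c * f) * pow (pow x f) (-c) = pow x r := by
  let := zmodModule hG
  apply Additive.ofMul.injective
  simp only [ofMul_mul, ofMul_pow_eq_smul hG]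
  module

theorem pow_pow_inv_add [Fact p.Prime] (hG : Fintype.card G = p) (x : G) {y : ZMod p}
    (hy : y ≠ 0) : pow (pow x y⁻¹) y = x := by
  let := zmodModule hG
  apply Additive.ofMul.injective
  simp only [ofMul_pow_eq_smul hG, smul_smul, mul_inv_cancel₀ hy, one_smul]

/-- With `a = γ` and `b = y` this turns `w * g₂^x` into `g₂^y`. -/
theorem pow_mul_pow_neg_add [NeZero p] (hG : Fintype.card G = p) (x : G) (a b : ZMod p) :
    pow x a * pow x (b - a) = pow x b := by
  let := zmodModule hG
  apply Additive.ofMul.injective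
  simp only [ofMul_mul, ofMul_pow_eq_smul hG]
  module

theorem pow_pow [NeZero p] (hG : Fintype.card G = p) (x : G) (a b : ZMod p) :
    pow (pow x a) b = pow x (b * a) := by
  let := zmodModule hG
  apply Additive.ofMul.injective
  simp only [ofMul_pow_eq_smul hG, smul_smul]

/-- The verification equation of the proof of knowledge of a credential. -/
theorem credential_response [NeZero p] (hG : Fintype.card G = p) {t s T₁ T₂ T₃ T₄ : G}
    {f x a : ZMod p}
    (h : s * pow t x = T₁ * pow T₂ f * pow T₃ (a * x) * pow T₄ a) (rf rx ra rb c : ZMod p) :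
    pow t (-(rx + c * x)) * pow s (-c) * pow T₁ c * pow T₂ (rf + c * f) *
        pow T₃ (rb + c * (a * x)) * pow T₄ (ra + c * a) =
      pow t (-rx) * pow T₂ rf * pow T₃ rb * pow T₄ ra := by
  let := zmodModule hG
  apply_fun Additive.ofMul at h
  apply Additive.ofMul.injective
  simp only [ofMul_mul, ofMul_pow_eq_smul hG] at h ⊢
  -- The terms containing `c` are exactly `-c` times the credential relation; the others are the
  -- commitment.
  linear_combination (norm := module) (-c) • h

variable {M N : Type} [Monoid M] [Monoid N]

theorem map_pow_zmod (φ : M →* N) (x : M) (a : ZMod p) : φ (pow x a) = pow (φ x) a :=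
  map_pow φ x _

omit [Fintype G] in
theorem pow_mul_distrib (x y : G) (a : ZMod p) : pow (x * y) a = pow x a * pow y a :=
  mul_pow x y _

end Pow

/-! ### Correctness of issuing, signing and verification -/

namespace BL

variable {B : BilinearFamily} (H : HashFamily B) {n : ℕ}

theorem pairing_pow_left (x : B.G₁ n) (y : B.G₂ n) (a : B.Z n) :
    B.e n (pow x a) y = pow (B.e n x y) a := by
  simp only [pow, map_pow, MonoidHom.pow_apply]

theorem pairing_pow_right (x : B.G₁ n) (y : B.G₂ n) (a : B.Z n) :
    B.e n x (pow y a) = pow (B.e n x y) a := map_pow_zmod _ _ _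

/-- The proof of knowledge made by the user in the join protocol is accepted. -/
theorem issue_join (pk : PubKey B n) (γ : B.Z n) (f : UserKey B n) (nonce : Fin n → Bool)
    (r : B.Z n) (y : (B.Z n)ˣ) :
    issue H false n pk γ (join H false n pk f nonce r) y =
      some ⟨pow (B.g₁ n * pow pk.h₁ (f : B.Z n)) (y : B.Z n)⁻¹, y - γ⟩ := by
  simp only [issue, join, pow_response (B.card₁ n), joinChallenge, if_true, sub_add_cancel]

/-- The exponent `y` moves from `g₂` to the first argument of the pairing, where it cancels `y⁻¹`.
Apart from `hw` nothing is asked of the public key, so the same lemma covers recomputed credentials.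
-/
theorem checkCred_issued {pk : PubKey B n} {γ : B.Z n} (hw : pk.w = pow (B.g₂ n) γ)
    (f : UserKey B n) (y : (B.Z n)ˣ) :
    checkCred n pk f ⟨pow (B.g₁ n * pow pk.h₁ (f : B.Z n)) (y : B.Z n)⁻¹, y - γ⟩ = true := by
  rw [checkCred, decide_eq_true_eq, hw, pow_mul_pow_neg_add (B.card₂ n), pairing_pow_right,
    ← pairing_pow_left, pow_pow_inv_add (B.card₁ n) _ y.ne_zero]

/-- The base of a signature. -/
def signBase (n : ℕ) (dom : Basename) (base₀ : B.G₁ n) : B.G₁ n := dom.elim base₀ (H.hashG n)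

/-- The commitment to the credential. -/
def signR₂ (n : ℕ) (pk : PubKey B n) (T : B.G₁ n) (rf rx ra rb : B.Z n) : B.GT n :=
  pow (B.e n T (B.g₂ n)) (-rx) * pow pk.T₂ rf * pow pk.T₃ rb * pow pk.T₄ ra

/-- The signature with given base, first component, and challenge. -/
def sigOf (n : ℕ) (f : UserKey B n) (k : Cred B n) (base T : B.G₁ n) (c : B.Z n)
    (r : SignCoins B n) : Sig B n :=
  ⟨base, pow base (f : B.Z n), T, c, r.2.1, r.2.2.2.1 + c * f, r.2.2.2.2.1 + c * k.x,
    r.2.2.2.2.2.1 + c * r.2.2.1, r.2.2.2.2.2.2 + c * (r.2.2.1 * k.x)⟩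

/-- Removes the pattern matching from `sign`; both correctness and the running time are read off
this form. -/
theorem sign_eq (n : ℕ) (pk : PubKey B n) (f : UserKey B n) (k : Cred B n) (dom : Basename)
    (m : Str) (r : SignCoins B n) :
    sign H n pk f k dom m r =
      sigOf n f k (signBase H n dom r.1) (k.A * pow pk.h₂ r.2.2.1)
        (signChallenge H n pk (signBase H n dom r.1) (pow (signBase H n dom r.1) (f : B.Z n))
          (k.A * pow pk.h₂ r.2.2.1) (pow (signBase H n dom r.1) r.2.2.2.1)
          (signR₂ n pk (k.A * pow pk.h₂ r.2.2.1) r.2.2.2.1 r.2.2.2.2.1 r.2.2.2.2.2.1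
            r.2.2.2.2.2.2) r.2.1 m) r := by
  cases dom <;> rfl

/-- The verifier recomputes the signer's commitment to the credential. -/
theorem verify_commitment {r₀ : B.G₁ n × B.G₁ n × B.Z n} {f : UserKey B n} {k : Cred B n}
    (hk : checkCred n (setup n r₀).1 f k = true) (a rf rx ra rb c : B.Z n) {pk : PubKey B n}
    (hpk : pk = (setup n r₀).1) :
    B.e n (k.A * pow pk.h₂ a) (pow (B.g₂ n) (-(rx + c * k.x)) * pow pk.w (-c)) *
        pow pk.T₁ c * pow pk.T₂ (rf + c * (f : B.Z n)) * pow pk.T₃ (rb + c * (a * k.x)) *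
        pow pk.T₄ (ra + c * a) =
      signR₂ n pk (k.A * pow pk.h₂ a) rf rx ra rb := by
  rw [checkCred, decide_eq_true_eq, ← hpk] at hk
  rw [map_mul (B.e n (k.A * pow pk.h₂ a)), pairing_pow_right, pairing_pow_right]
  refine credential_response (B.cardT n) ?_ _ _ _ _ _
  -- It remains to evaluate `e(T, w g₂^x)` for `T = A h₂^a`. The factor `A` contributes `e(g₁ h₁^f,
  -- g₂) = T₁ T₂^f` by `hk`, and `h₂^a` contributes `T₄^a T₃^(ax)`.
  rw [← pairing_pow_right, ← map_mul (B.e n (k.A * pow pk.h₂ a)), map_mul (B.e n),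
    MonoidHom.mul_apply, hk, pairing_pow_left, map_mul (B.e n pk.h₂), pairing_pow_right,
    pow_mul_distrib, pow_pow (B.cardT n), map_mul (B.e n), MonoidHom.mul_apply, pairing_pow_left,
    mul_comm (pow (B.e n pk.h₂ pk.w) a), ← mul_assoc, hpk]
  rfl

/-- Both recomputed commitments equal the signer's, so the verifier hashes the same data. -/
theorem verify_sign {r₀ : B.G₁ n × B.G₁ n × B.Z n} {f : UserKey B n} {k : Cred B n}
    (hk : checkCred n (setup n r₀).1 f k = true) (dom : Basename) (m : Str) (r : SignCoins B n) :
    verify H n (setup n r₀).1 m dom (sign H n (setup n r₀).1 f k dom m r) [] = true := by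
  rw [sign_eq, verify, decide_eq_true_eq]
  refine ⟨?_, ?_, by simp⟩
  · rintro d rfl
    rfl
  · simp only [sigOf, pow_response (B.card₁ n), verify_commitment hk _ _ _ _ _ _ rfl]

end BL

theorem brickellLi_isCorrect (B : BilinearFamily) (H : HashFamily B) :
    (brickellLi B H false).IsCorrect := by
  intro n r f nonce rj ri
  have hk := BL.checkCred_issued (pk := (BL.setup n r).1) (γ := r.2.2) rfl f ri
  refine ⟨_, BL.issue_join H _ _ f nonce rj ri, fun dom m₀ m₁ r₀ r₁ => ?_⟩
  have h₀ := BL.verify_sign H hk dom m₀ r₀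
  have h₁ := BL.verify_sign H hk dom m₁ r₁
  refine ⟨h₀, h₁, fun hdom => ?_⟩
  refine (if_pos ⟨h₀, h₁⟩).trans ?_
  -- For a basename `d` the base is the hash of `d` and the pseudonym its power `f`, neither
  -- depending on the signer's coins.
  obtain ⟨d, rfl⟩ := Option.ne_none_iff_exists'.1 hdom
  exact congrArg some (decide_eq_true ⟨rfl, rfl⟩)

theorem brickellLiSplit_issue_valid (B : BilinearFamily) (H : HashFamily B) (n : ℕ) (h₁ : B.G₁ n)
    (f : BL.UserKey B n) (nonce : Fin n → Bool) (rj : B.Z n) (r₂ : B.G₁ n × B.Z n)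
    (ri : (B.Z n)ˣ) :
    ∃ cred, BL.issue H false n ((brickellLiSplit B H).keys n h₁ r₂).1
        ((brickellLiSplit B H).keys n h₁ r₂).2 (BL.user H n h₁ f nonce rj) ri = some cred ∧
      BL.checkCred n ((brickellLiSplit B H).keys n h₁ r₂).1 f cred = true :=
  -- `BL.user` at `h₁` is by definition the modified `BL.join` at any key extending `h₁`, and `rfl`
  -- is `w = g₂^γ`.
  ⟨_, BL.issue_join H _ _ f nonce rj ri, BL.checkCred_issued rfl f ri⟩

/-! ## Polynomial size -/

section PolySize

variable {X Y : ℕ → Type} [∀ n, Coded (X n)] [∀ n, Coded (Y n)]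

theorem PolySize.prod (hX : PolySize X) (hY : PolySize Y) : PolySize fun n => X n × Y n := by
  obtain ⟨p, hp⟩ := hX
  obtain ⟨q, hq⟩ := hY
  refine ⟨p + q + 1, fun n x => ?_⟩
  change (Coded.enc x.1).size + (Coded.enc x.2).size + 1 ≤ _
  simp only [Polynomial.eval_add, Polynomial.eval_one]
  have := hp n x.1
  have := hq n x.2
  omega

theorem PolySize.units [∀ n, Monoid (X n)] (hX : PolySize X) : PolySize fun n => (X n)ˣ := by
  obtain ⟨p, hp⟩ := hX
  exact ⟨p, fun n x => hp n x⟩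

/-- Each entry costs at most 3 for the boolean and 1 for its node; the final `nil` costs 1. -/
theorem encList_bool_size_le (l : List Bool) : (encList l).size ≤ 4 * l.length + 1 := by
  induction l with
  | nil => simp [encList, Data.size]
  | cons b l ih =>
    have : (Coded.enc b).size ≤ 3 := by revert b; decide
    simp only [encList, Data.size, List.length_cons]
    omega

theorem polySize_bits : PolySize fun n => Fin n → Bool := by
  refine ⟨4 * .X + 1, fun n v => ?_⟩
  change (encList (List.ofFn v)).size ≤ _
  simpa only [List.length_ofFn, Polynomial.eval_add, Polynomial.eval_mul, Polynomial.eval_X,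
    Polynomial.eval_ofNat, Polynomial.eval_one] using encList_bool_size_le (List.ofFn v)

end PolySize

/-! ## Polynomial-time computations in bilinear groups -/

section Arithmetic

variable {X : ℕ → Type} [∀ n, Coded (X n)] {B : BilinearFamily}

namespace BilinearFamily.IsEfficient

theorem zadd (hB : B.IsEfficient) {f g : ∀ n, X n → B.Z n} (hf : PolyTime f) (hg : PolyTime g) :
    PolyTime fun n x => f n x + g n x := hB.add.comp (hf.prodMk hg)

theorem zneg (hB : B.IsEfficient) {f : ∀ n, X n → B.Z n} (hf : PolyTime f) :
    PolyTime fun n x => -f n x := hB.neg.comp hf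

theorem zsub (hB : B.IsEfficient) {f g : ∀ n, X n → B.Z n} (hf : PolyTime f) (hg : PolyTime g) :
    PolyTime fun n x => f n x - g n x := by
  simpa only [sub_eq_add_neg] using hB.zadd hf (hB.zneg hg)

theorem zmul (hB : B.IsEfficient) {f g : ∀ n, X n → B.Z n} (hf : PolyTime f) (hg : PolyTime g) :
    PolyTime fun n x => f n x * g n x := hB.mul.comp (hf.prodMk hg)

theorem zinv (hB : B.IsEfficient) {f : ∀ n, X n → B.Z n} (hf : PolyTime f) :
    PolyTime fun n x => (f n x)⁻¹ := hB.inv.comp hf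

theorem gmul₁ (hB : B.IsEfficient) {f g : ∀ n, X n → B.G₁ n} (hf : PolyTime f)
    (hg : PolyTime g) : PolyTime fun n x => f n x * g n x := hB.mul₁.comp (hf.prodMk hg)

theorem gmul₂ (hB : B.IsEfficient) {f g : ∀ n, X n → B.G₂ n} (hf : PolyTime f)
    (hg : PolyTime g) : PolyTime fun n x => f n x * g n x := hB.mul₂.comp (hf.prodMk hg)

theorem gmulT (hB : B.IsEfficient) {f g : ∀ n, X n → B.GT n} (hf : PolyTime f)
    (hg : PolyTime g) : PolyTime fun n x => f n x * g n x := hB.mulT.comp (hf.prodMk hg)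

theorem gpow₁ (hB : B.IsEfficient) {f : ∀ n, X n → B.G₁ n} {a : ∀ n, X n → B.Z n}
    (hf : PolyTime f) (ha : PolyTime a) : PolyTime fun n x => pow (f n x) (a n x) :=
  hB.pow₁.comp (hf.prodMk ha)

theorem gpow₂ (hB : B.IsEfficient) {f : ∀ n, X n → B.G₂ n} {a : ∀ n, X n → B.Z n}
    (hf : PolyTime f) (ha : PolyTime a) : PolyTime fun n x => pow (f n x) (a n x) :=
  hB.pow₂.comp (hf.prodMk ha)

theorem gpowT (hB : B.IsEfficient) {f : ∀ n, X n → B.GT n} {a : ∀ n, X n → B.Z n}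
    (hf : PolyTime f) (ha : PolyTime a) : PolyTime fun n x => pow (f n x) (a n x) :=
  hB.powT.comp (hf.prodMk ha)

theorem g₁_const (hB : B.IsEfficient) : PolyTime fun n (_ : X n) => B.g₁ n :=
  hB.gen₁.comp PolyTime.unit

theorem g₂_const (hB : B.IsEfficient) : PolyTime fun n (_ : X n) => B.g₂ n :=
  hB.gen₂.comp PolyTime.unit

theorem pair (hB : B.IsEfficient) {f : ∀ n, X n → B.G₁ n} {g : ∀ n, X n → B.G₂ n}
    (hf : PolyTime f) (hg : PolyTime g) : PolyTime fun n x => B.e n (f n x) (g n x) :=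
  hB.pairing.comp (hf.prodMk hg)

end BilinearFamily.IsEfficient

theorem PolyTime.unitsVal {f : ∀ n, X n → (B.Z n)ˣ} (hf : PolyTime f) :
    PolyTime fun n x => (f n x : B.Z n) :=
  (of_enc_eq (f := fun n (u : (B.Z n)ˣ) => (u : B.Z n)) fun _ _ => rfl).comp hf

end Arithmetic

/-! ## The algorithms of the scheme are polynomial-time -/

namespace BL

section Structures

variable {B : BilinearFamily} {X : ℕ → Type} [∀ n, Coded (X n)]

/-- A structure has the same code as the tuple of its fields, so passing between them leaves the
tree unchanged. The other structures are handled alike. -/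
theorem PubKey.polyTime_fields {f : ∀ n, X n → PubKey B n} (hf : PolyTime f) :
    PolyTime (fun n x => (f n x).h₁) ∧ PolyTime (fun n x => (f n x).h₂) ∧
      PolyTime (fun n x => (f n x).w) ∧ PolyTime (fun n x => (f n x).T₁) ∧
      PolyTime (fun n x => (f n x).T₂) ∧ PolyTime (fun n x => (f n x).T₃) ∧
      PolyTime (fun n x => (f n x).T₄) := by
  have h := (PolyTime.of_enc_eq (f := fun n (k : PubKey B n) =>
    (k.h₁, k.h₂, k.w, k.T₁, k.T₂, k.T₃, k.T₄)) fun _ _ => rfl).comp hf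
  exact ⟨h.fst, h.snd.fst, h.snd.snd.fst, h.snd.snd.snd.fst, h.snd.snd.snd.snd.fst,
    h.snd.snd.snd.snd.snd.fst, h.snd.snd.snd.snd.snd.snd⟩

theorem EphKey.polyTime_mk {h₂ : ∀ n, X n → B.G₁ n} {w : ∀ n, X n → B.G₂ n}
    {T₁ T₂ T₃ T₄ : ∀ n, X n → B.GT n} (hh₂ : PolyTime h₂) (hw : PolyTime w) (hT₁ : PolyTime T₁)
    (hT₂ : PolyTime T₂) (hT₃ : PolyTime T₃) (hT₄ : PolyTime T₄) :
    PolyTime fun n x =>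
      (⟨h₂ n x, w n x, T₁ n x, T₂ n x, T₃ n x, T₄ n x⟩ : EphKey B n) :=
  (PolyTime.of_enc_eq (f := fun n (k : B.G₁ n × B.G₂ n × B.GT n × B.GT n × B.GT n × B.GT n) =>
    (⟨k.1, k.2.1, k.2.2.1, k.2.2.2.1, k.2.2.2.2.1, k.2.2.2.2.2⟩ : EphKey B n))
    fun _ _ => rfl).comp
    (hh₂.prodMk (hw.prodMk (hT₁.prodMk (hT₂.prodMk (hT₃.prodMk hT₄)))))

/-- Nested pairs associate to the right, so putting `h₁` in front of an ephemeral key already gives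
the code of the public key. Thus `setup` reduces to `setup2`. -/
theorem PubKey.polyTime_mk {h₁ : ∀ n, X n → B.G₁ n} {k : ∀ n, X n → EphKey B n}
    (hh₁ : PolyTime h₁) (hk : PolyTime k) :
    PolyTime fun n x => (⟨h₁ n x, (k n x).h₂, (k n x).w, (k n x).T₁, (k n x).T₂, (k n x).T₃,
      (k n x).T₄⟩ : PubKey B n) :=
  (PolyTime.of_enc_eq (f := fun n (k : B.G₁ n × EphKey B n) =>
    (⟨k.1, k.2.h₂, k.2.w, k.2.T₁, k.2.T₂, k.2.T₃, k.2.T₄⟩ : PubKey B n)) fun _ _ => rfl).comp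
    (hh₁.prodMk hk)

theorem Com.polyTime_fields {f : ∀ n, X n → Com B n} (hf : PolyTime f) :
    PolyTime (fun n x => (f n x).F) ∧ PolyTime (fun n x => (f n x).c) ∧
      PolyTime (fun n x => (f n x).s) ∧ PolyTime (fun n x => (f n x).nonce) := by
  have h := (PolyTime.of_enc_eq (f := fun n (k : Com B n) => (k.F, k.c, k.s, k.nonce))
    fun _ _ => rfl).comp hf
  exact ⟨h.fst, h.snd.fst, h.snd.snd.fst, h.snd.snd.snd⟩

theorem Com.polyTime_mk {F : ∀ n, X n → B.G₁ n} {c s : ∀ n, X n → B.Z n}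
    {nonce : ∀ n, X n → Fin n → Bool} (hF : PolyTime F) (hc : PolyTime c) (hs : PolyTime s)
    (hn : PolyTime nonce) :
    PolyTime fun n x => (⟨F n x, c n x, s n x, nonce n x⟩ : Com B n) :=
  (PolyTime.of_enc_eq (f := fun n (k : B.G₁ n × B.Z n × B.Z n × (Fin n → Bool)) =>
    (⟨k.1, k.2.1, k.2.2.1, k.2.2.2⟩ : Com B n)) fun _ _ => rfl).comp
    (hF.prodMk (hc.prodMk (hs.prodMk hn)))

theorem Cred.polyTime_fields {f : ∀ n, X n → Cred B n} (hf : PolyTime f) :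
    PolyTime (fun n x => (f n x).A) ∧ PolyTime (fun n x => (f n x).x) := by
  have h := (PolyTime.of_enc_eq (f := fun n (k : Cred B n) => (k.A, k.x)) fun _ _ => rfl).comp hf
  exact ⟨h.fst, h.snd⟩

theorem Cred.polyTime_mk {A : ∀ n, X n → B.G₁ n} {a : ∀ n, X n → B.Z n} (hA : PolyTime A)
    (ha : PolyTime a) : PolyTime fun n x => (⟨A n x, a n x⟩ : Cred B n) :=
  (PolyTime.of_enc_eq (f := fun n (k : B.G₁ n × B.Z n) => (⟨k.1, k.2⟩ : Cred B n))
    fun _ _ => rfl).comp (hA.prodMk ha)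

theorem Sig.polyTime_fields {f : ∀ n, X n → Sig B n} (hf : PolyTime f) :
    PolyTime (fun n x => (f n x).base) ∧ PolyTime (fun n x => (f n x).nym) ∧
      PolyTime (fun n x => (f n x).T) ∧ PolyTime (fun n x => (f n x).c) ∧
      PolyTime (fun n x => (f n x).nonce) ∧ PolyTime (fun n x => (f n x).sf) ∧
      PolyTime (fun n x => (f n x).sx) ∧ PolyTime (fun n x => (f n x).sa) ∧
      PolyTime (fun n x => (f n x).sb) := by
  have h := (PolyTime.of_enc_eq (f := fun n (k : Sig B n) =>
    (k.base, k.nym, k.T, k.c, k.nonce, k.sf, k.sx, k.sa, k.sb)) fun _ _ => rfl).comp hf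
  exact ⟨h.fst, h.snd.fst, h.snd.snd.fst, h.snd.snd.snd.fst, h.snd.snd.snd.snd.fst,
    h.snd.snd.snd.snd.snd.fst, h.snd.snd.snd.snd.snd.snd.fst,
    h.snd.snd.snd.snd.snd.snd.snd.fst, h.snd.snd.snd.snd.snd.snd.snd.snd⟩

theorem Sig.polyTime_mk {b y T : ∀ n, X n → B.G₁ n} {c sf sx sa sb : ∀ n, X n → B.Z n}
    {nonce : ∀ n, X n → Fin n → Bool} (hb : PolyTime b) (hy : PolyTime y) (hT : PolyTime T)
    (hc : PolyTime c) (hn : PolyTime nonce) (hsf : PolyTime sf) (hsx : PolyTime sx)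
    (hsa : PolyTime sa) (hsb : PolyTime sb) :
    PolyTime fun n x => (⟨b n x, y n x, T n x, c n x, nonce n x, sf n x, sx n x, sa n x,
      sb n x⟩ : Sig B n) :=
  (PolyTime.of_enc_eq (f := fun n (k : B.G₁ n × B.G₁ n × B.G₁ n × B.Z n × (Fin n → Bool) ×
      B.Z n × B.Z n × B.Z n × B.Z n) =>
    (⟨k.1, k.2.1, k.2.2.1, k.2.2.2.1, k.2.2.2.2.1, k.2.2.2.2.2.1, k.2.2.2.2.2.2.1,
      k.2.2.2.2.2.2.2.1, k.2.2.2.2.2.2.2.2⟩ : Sig B n)) fun _ _ => rfl).comp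
    (hb.prodMk (hy.prodMk (hT.prodMk (hc.prodMk (hn.prodMk (hsf.prodMk (hsx.prodMk
      (hsa.prodMk hsb))))))))

end Structures

variable {B : BilinearFamily} (hB : B.IsEfficient) {H : HashFamily B} (hH : H.IsEfficient)

include hB

theorem setup2_polyTime :
    PolyTime fun n (x : B.G₁ n × B.G₁ n × B.Z n) => setup2 n x.1 x.2 := by
  have hx : PolyTime fun n (x : B.G₁ n × B.G₁ n × B.Z n) => x := .id
  have hw := hB.gpow₂ hB.g₂_const hx.snd.snd
  exact (EphKey.polyTime_mk hx.snd.fst hw (hB.pair hB.g₁_const hB.g₂_const)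
    (hB.pair hx.fst hB.g₂_const) (hB.pair hx.snd.fst hB.g₂_const)
    (hB.pair hx.snd.fst hw)).prodMk hx.snd.snd

theorem setup_polyTime : PolyTime (setup (B := B)) :=
  (PubKey.polyTime_mk PolyTime.id.fst (setup2_polyTime hB).fst).prodMk (setup2_polyTime hB).snd

include hH

omit hB in
theorem joinChallenge_polyTime :
    PolyTime fun n (x : (Fin n → Bool) × B.G₁ n × B.G₁ n) => H.hash n (Coded.enc x) :=
  hH.hash.comp .enc

theorem user_polyTime :
    PolyTime fun n (x : B.G₁ n × UserKey B n × (Fin n → Bool) × B.Z n) =>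
      user H n x.1 x.2.1 x.2.2.1 x.2.2.2 := by
  have hx : PolyTime fun n (x : B.G₁ n × UserKey B n × (Fin n → Bool) × B.Z n) => x := .id
  have hf := hx.snd.fst.unitsVal
  have hF := hB.gpow₁ hx.fst hf
  have hR := hB.gpow₁ hx.fst hx.snd.snd.snd
  have hc := (joinChallenge_polyTime hH).comp (hx.snd.snd.fst.prodMk (hF.prodMk hR))
  exact Com.polyTime_mk hF hc (hB.zadd hx.snd.snd.snd (hB.zmul hc hf)) hx.snd.snd.fst

theorem join_polyTime :
    PolyTime fun n (x : PubKey B n × UserKey B n × (Fin n → Bool) × B.Z n) =>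
      join H false n x.1 x.2.1 x.2.2.1 x.2.2.2 := by
  have hx : PolyTime fun n (x : PubKey B n × UserKey B n × (Fin n → Bool) × B.Z n) => x := .id
  -- The modified join step is by definition `user` applied to the field `h₁`.
  exact (user_polyTime hB hH).comp ((PubKey.polyTime_fields hx.fst).1.prodMk hx.snd)

theorem issue_polyTime :
    PolyTime fun n (x : PubKey B n × B.Z n × Com B n × (B.Z n)ˣ) =>
      issue H false n x.1 x.2.1 x.2.2.1 x.2.2.2 := by
  have hx : PolyTime fun n (x : PubKey B n × B.Z n × Com B n × (B.Z n)ˣ) => x := .id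
  obtain ⟨hF, hc, hs, hn⟩ := Com.polyTime_fields hx.snd.snd.fst
  have hR := hB.gmul₁ (hB.gpow₁ (PubKey.polyTime_fields hx.fst).1 hs) (hB.gpow₁ hF (hB.zneg hc))
  have hch := (joinChallenge_polyTime hH).comp (hn.prodMk (hF.prodMk hR))
  have hxx := hB.zsub hx.snd.snd.snd.unitsVal hx.snd.fst
  exact PolyTime.ite (hc.decide_eq hch)
    (Cred.polyTime_mk (hB.gpow₁ (hB.gmul₁ hB.g₁_const hF) (hB.zinv (hB.zadd hxx hx.snd.fst)))
      hxx).some .none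

omit hH in
theorem checkCred_polyTime :
    PolyTime fun n (x : PubKey B n × UserKey B n × Cred B n) => checkCred n x.1 x.2.1 x.2.2 := by
  have hx : PolyTime fun n (x : PubKey B n × UserKey B n × Cred B n) => x := .id
  obtain ⟨hh₁, -, hw, -⟩ := PubKey.polyTime_fields hx.fst
  obtain ⟨hA, hxx⟩ := Cred.polyTime_fields hx.snd.snd
  exact (hB.pair hA (hB.gmul₂ hw (hB.gpow₂ hB.g₂_const hxx))).decide_eq
    (hB.pair (hB.gmul₁ hB.g₁_const (hB.gpow₁ hh₁ hx.snd.fst.unitsVal)) hB.g₂_const)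

omit hB in
theorem signChallenge_polyTime :
    PolyTime fun n (x : (PubKey B n × B.G₁ n × B.G₁ n × B.G₁ n × B.G₁ n × B.GT n) ×
        (Fin n → Bool) × Str) =>
      signChallenge H n x.1.1 x.1.2.1 x.1.2.2.1 x.1.2.2.2.1 x.1.2.2.2.2.1 x.1.2.2.2.2.2
        x.2.1 x.2.2 := by
  have hx : PolyTime fun n (x : (PubKey B n × B.G₁ n × B.G₁ n × B.G₁ n × B.G₁ n × B.GT n) ×
    (Fin n → Bool) × Str) => x := .id
  exact hH.hash.comp (PolyTime.enc.comp ((hH.hash.comp (PolyTime.enc.comp hx.fst)).prodMk hx.snd))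

omit hB in
theorem signBase_polyTime :
    PolyTime fun n (x : Basename × B.G₁ n) => signBase H n x.1 x.2 :=
  PolyTime.option_elim (g := fun n y => H.hashG n y.2) PolyTime.id.fst PolyTime.id.snd
    (hH.hashG.comp PolyTime.id.snd)

theorem sign_polyTime :
    PolyTime fun n (x : PubKey B n × UserKey B n × Cred B n × Basename × Str × SignCoins B n) =>
      sign H n x.1 x.2.1 x.2.2.1 x.2.2.2.1 x.2.2.2.2.1 x.2.2.2.2.2 := by
  simp only [sign_eq]
  have hx : PolyTime fun n
    (x : PubKey B n × UserKey B n × Cred B n × Basename × Str × SignCoins B n) => x := .id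
  have hpk := hx.fst
  have hf := hx.snd.fst.unitsVal
  have hm := hx.snd.snd.snd.snd.fst
  have hr := hx.snd.snd.snd.snd.snd
  have hn := hr.snd.fst
  have ha := hr.snd.snd.fst
  have hrf := hr.snd.snd.snd.fst
  have hrx := hr.snd.snd.snd.snd.fst
  have hra := hr.snd.snd.snd.snd.snd.fst
  have hrb := hr.snd.snd.snd.snd.snd.snd
  obtain ⟨-, hh₂, hw, hT₁, hT₂, hT₃, hT₄⟩ := PubKey.polyTime_fields hpk
  obtain ⟨hA, hxx⟩ := Cred.polyTime_fields hx.snd.snd.fst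
  have hbase := (signBase_polyTime hH).comp (hx.snd.snd.snd.fst.prodMk hr.fst)
  have hnym := hB.gpow₁ hbase hf
  have hT := hB.gmul₁ hA (hB.gpow₁ hh₂ ha)
  have hR₁ := hB.gpow₁ hbase hrf
  have hR₂ := hB.gmulT (hB.gmulT (hB.gmulT (hB.gpowT (hB.pair hT hB.g₂_const) (hB.zneg hrx))
    (hB.gpowT hT₂ hrf)) (hB.gpowT hT₃ hrb)) (hB.gpowT hT₄ hra)
  have hc := (signChallenge_polyTime hH).comp
    ((hpk.prodMk (hbase.prodMk (hnym.prodMk (hT.prodMk (hR₁.prodMk hR₂))))).prodMk (hn.prodMk hm))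
  exact Sig.polyTime_mk hbase hnym hT hc hn (hB.zadd hrf (hB.zmul hc hf))
    (hB.zadd hrx (hB.zmul hc hxx)) (hB.zadd hra (hB.zmul hc ha))
    (hB.zadd hrb (hB.zmul hc (hB.zmul ha hxx)))

-- Replaces the quantifiers over `dom` and the revocation list by `Option.elim` and `List.all`, for
-- which there are polynomial-time combinators.
omit hB hH in
theorem verify_eq (n : ℕ) (pk : PubKey B n) (m : Str) (dom : Basename) (σ : Sig B n)
    (RL : List (UserKey B n)) :
    verify H n pk m dom σ RL =
      (dom.elim true (fun d => decide (σ.base = H.hashG n d)) &&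
      (decide (σ.c = signChallenge H n pk σ.base σ.nym σ.T
        (pow σ.base σ.sf * pow σ.nym (-σ.c))
        (B.e n σ.T (pow (B.g₂ n) (-σ.sx) * pow pk.w (-σ.c)) * pow pk.T₁ σ.c * pow pk.T₂ σ.sf *
          pow pk.T₃ σ.sb * pow pk.T₄ σ.sa) σ.nonce m) &&
      RL.all fun f => !decide (σ.nym = pow σ.base (f : B.Z n)))) := by
  rw [verify, Bool.eq_iff_iff, decide_eq_true_eq]
  cases dom <;> simp

theorem verify_polyTime :
    PolyTime fun n (x : PubKey B n × Str × Basename × Sig B n × List (UserKey B n)) =>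
      verify H n x.1 x.2.1 x.2.2.1 x.2.2.2.1 x.2.2.2.2 := by
  simp only [verify_eq]
  have hx : PolyTime fun n
    (x : PubKey B n × Str × Basename × Sig B n × List (UserKey B n)) => x := .id
  obtain ⟨-, -, hw, hT₁, hT₂, hT₃, hT₄⟩ := PubKey.polyTime_fields hx.fst
  obtain ⟨hbase, hnym, hT, hc, hn, hsf, hsx, hsa, hsb⟩ :=
    Sig.polyTime_fields hx.snd.snd.snd.fst
  have hR₁ := hB.gmul₁ (hB.gpow₁ hbase hsf) (hB.gpow₁ hnym (hB.zneg hc))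
  have hR₂ := hB.gmulT (hB.gmulT (hB.gmulT (hB.gmulT
    (hB.pair hT (hB.gmul₂ (hB.gpow₂ hB.g₂_const (hB.zneg hsx)) (hB.gpow₂ hw (hB.zneg hc))))
    (hB.gpowT hT₁ hc)) (hB.gpowT hT₂ hsf)) (hB.gpowT hT₃ hsb)) (hB.gpowT hT₄ hsa)
  have hch := (signChallenge_polyTime hH).comp
    ((hx.fst.prodMk (hbase.prodMk (hnym.prodMk (hT.prodMk (hR₁.prodMk hR₂))))).prodMk
      (hn.prodMk hx.snd.fst))
  refine .and (PolyTime.option_elim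
    (g := fun n (y : (PubKey B n × Str × Basename × Sig B n × List (UserKey B n)) × Str) =>
      decide (y.1.2.2.2.1.base = H.hashG n y.2)) hx.snd.snd.fst .true ?_)
    (.and (hc.decide_eq hch) (PolyTime.list_all
    (b := fun n
      (y : (PubKey B n × Str × Basename × Sig B n × List (UserKey B n)) × UserKey B n) =>
      !decide (y.1.2.2.2.1.nym = pow y.1.2.2.2.1.base (y.2 : B.Z n)))
    hx.snd.snd.snd.snd ?_))
  · exact (hbase.comp PolyTime.id.fst).decide_eq (hH.hashG.comp PolyTime.id.snd)
  · exact ((hnym.comp PolyTime.id.fst).decide_eq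
      (hB.gpow₁ (hbase.comp PolyTime.id.fst) PolyTime.id.snd.unitsVal)).not

omit hB hH in
theorem link_eq (n : ℕ) (pk : PubKey B n) (RL : List (UserKey B n))
    (x y : Str × Basename × Sig B n) :
    link H n pk RL x y =
      bif verify H n pk x.1 x.2.1 x.2.2 RL && verify H n pk y.1 y.2.1 y.2.2 RL then
        some (decide (x.2.2.base = y.2.2.base) && decide (x.2.2.nym = y.2.2.nym))
      else none := by
  rw [link, Bool.cond_eq_ite]
  simp only [Bool.and_eq_true, Bool.decide_and]

theorem link_polyTime :
    PolyTime fun n (x : PubKey B n × List (UserKey B n) × (Str × Basename × Sig B n) ×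
        (Str × Basename × Sig B n)) =>
      link H n x.1 x.2.1 x.2.2.1 x.2.2.2 := by
  simp only [link_eq]
  have hx : PolyTime fun n (x : PubKey B n × List (UserKey B n) × (Str × Basename × Sig B n) ×
    (Str × Basename × Sig B n)) => x := .id
  have hv := verify_polyTime hB hH
  have hs₀ := hx.snd.snd.fst
  have hs₁ := hx.snd.snd.snd
  obtain ⟨hb₀, hn₀, -⟩ := Sig.polyTime_fields hs₀.snd.snd
  obtain ⟨hb₁, hn₁, -⟩ := Sig.polyTime_fields hs₁.snd.snd
  exact .bool_cond
    (.and (hv.comp (hx.fst.prodMk (hs₀.fst.prodMk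
        (hs₀.snd.fst.prodMk (hs₀.snd.snd.prodMk hx.snd.fst)))))
      (hv.comp (hx.fst.prodMk (hs₁.fst.prodMk
        (hs₁.snd.fst.prodMk (hs₁.snd.snd.prodMk hx.snd.fst))))))
    (PolyTime.some (.and (hb₀.decide_eq hb₁) (hn₀.decide_eq hn₁))) .none

end BL

theorem brickellLi_isPPT {B : BilinearFamily} (hB : B.IsEfficient) {H : HashFamily B}
    (hH : H.IsEfficient) : (brickellLi B H false).IsPPT where
  setupCoins := hB.size₁.prod (hB.size₁.prod hB.sizeZ)
  joinCoins := hB.sizeZ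
  issueCoins := hB.sizeZ.units
  signCoins := hB.size₁.prod (polySize_bits.prod (hB.sizeZ.prod (hB.sizeZ.prod
    (hB.sizeZ.prod (hB.sizeZ.prod hB.sizeZ)))))
  userKey := hB.sizeZ.units
  nonce := polySize_bits
  setup := BL.setup_polyTime hB
  join := BL.join_polyTime hB hH
  issue := BL.issue_polyTime hB hH
  checkCred := BL.checkCred_polyTime hB
  sign := BL.sign_polyTime hB hH
  verify := BL.verify_polyTime hB hH
  link := BL.link_polyTime hB hH

/-! ## Updateability -/

/-- Each pair has probability `1 / (|α| |β|)` on both sides. This lets the coins of the setup be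
drawn in two stages, first `h₁`, then `(h₂, γ)`. -/
theorem unif_prod (α β : Type) [Fintype α] [Fintype β] [Nonempty α] [Nonempty β] :
    unif (α × β) = (unif α).bind fun a => (unif β).map fun b => (a, b) := by
  ext ⟨a, b⟩
  simp only [PMF.bind_apply, PMF.map_apply, tsum_fintype, PMF.uniformOfFintype_apply,
    Fintype.card_prod, Nat.cast_mul, Prod.mk.injEq, ite_and, Finset.sum_ite_irrel,
    Finset.sum_const_zero, mul_ite, mul_zero, Finset.sum_ite_eq, Finset.mem_univ, if_true]
  exact ENNReal.mul_inv (.inr (ENNReal.natCast_ne_top _)) (.inl (ENNReal.natCast_ne_top _))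

theorem brickellLi_setupDist (B : BilinearFamily) (H : HashFamily B) (n : ℕ) :
    (brickellLi B H false).setupDist n =
      (unif ((brickellLiSplit B H).Coins₁ n)).bind fun r₁ =>
        (unif ((brickellLiSplit B H).Coins₂ n)).map fun r₂ => (brickellLiSplit B H).keys n r₁ r₂ := by
  change (unif (B.G₁ n × B.G₁ n × B.Z n)).map (BL.setup n) = _
  rw [unif_prod, PMF.map_bind]
  simp only [PMF.map_comp]
  rfl

/-- An adversary without auxiliary information that feeds a function of its input to the given
adversary. -/
def Adversary.pull {In In' Q R : ℕ → Type} (A : Adversary In Q R) (φ : ∀ n, In' n → In n) :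
    Adversary In' Q R where
  tapeLength := A.tapeLength
  rounds := A.rounds
  next := fun n x => A.next n (φ n x.1, x.2)

theorem Adversary.IsPPT.pull {In In' Q R : ℕ → Type} [∀ n, Coded (In n)] [∀ n, Coded (In' n)]
    [∀ n, Coded (Q n)] [∀ n, Coded (R n)] {A : Adversary In Q R} (hA : A.IsPPT)
    {φ : ∀ n, In' n → In n} (hφ : PolyTime φ) : (A.pull φ).IsPPT :=
  PolyTime.comp (g := A.next) hA ((hφ.comp PolyTime.id.fst).prodMk PolyTime.id.snd)

/-- In a generated key the field `h₁` is the coin of the persistent setup itself. The simulator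
therefore hands over exactly what the leaking setup would, and no probability is lost. -/
theorem brickellLi_anonAdv_pull (B : BilinearFamily) (H : HashFamily B)
    (A : AnonAdversary (brickellLi B H false) (brickellLiSplit B H).Coins₁) (n : ℕ) :
    anonAdv _ (brickellLi B H false).plainGen
        (A.pull fun _ k => (k.1, BL.PubKey.h₁ k.1.1)) n =
      anonAdv _ (brickellLiSplit B H).leakGen A n := by
  unfold anonAdv anonExp
  rw [Scheme.plainGen, brickellLi_setupDist, Split.leakGen]
  simp only [PMF.map_bind, PMF.bind_bind, PMF.bind_map]
  rfl

/-- The same simulation works without the issuer's secret key, since `h₁` is part of the public key.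
-/
theorem brickellLi_traceAdv_pull (B : BilinearFamily) (H : HashFamily B)
    (A : TraceAdversary (brickellLi B H false) (brickellLiSplit B H).Coins₁) (n : ℕ) :
    traceAdv _ (brickellLi B H false).plainGen
        (A.pull fun _ k => (k.1, BL.PubKey.h₁ k.1)) n =
      traceAdv _ (brickellLiSplit B H).leakGen A n := by
  unfold traceAdv traceExp
  rw [Scheme.plainGen, brickellLi_setupDist, Split.leakGen]
  simp only [PMF.map_bind, PMF.bind_bind, PMF.bind_map]
  rfl

theorem negligible_zero : Negligible fun _ => 0 :=
  Asymptotics.superpolynomialDecay_zero _ _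

theorem brickellLiSplit_isUpdateable {B : BilinearFamily} (hB : B.IsEfficient)
    {H : HashFamily B} (hH : H.IsEfficient) : (brickellLiSplit B H).IsUpdateable where
  coins₁_size := hB.size₁
  coins₂_size := hB.size₁.prod hB.sizeZ
  setup1_ppt := PolyTime.id (X := B.G₁)
  setup2_ppt := BL.setup2_polyTime hB
  user_ppt := BL.user_polyTime hB hH
  setup_eq := brickellLi_setupDist B H
  join_eq := fun _ _ _ _ _ _ => rfl
  issue_valid := brickellLiSplit_issue_valid B H
  anon_public_coins := fun A hA => by
    have hx : PolyTime fun n (x : (BL.PubKey B n × B.Z n) × Unit) => x := .id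
    exact ⟨_, hA.pull (hx.fst.prodMk (BL.PubKey.polyTime_fields hx.fst.fst).1), _,
      negligible_zero, fun n => by rw [add_zero]; exact (brickellLi_anonAdv_pull B H A n).ge⟩
  trace_public_coins := fun A hA => by
    have hx : PolyTime fun n (x : BL.PubKey B n × Unit) => x := .id
    exact ⟨_, hA.pull (hx.fst.prodMk (BL.PubKey.polyTime_fields hx.fst).1), _,
      negligible_zero, fun n => by rw [add_zero]; exact (brickellLi_traceAdv_pull B H A n).ge⟩

end UpdDAA

end

theorem mainTheorem8 (B : UpdDAA.BilinearFamily) (hB : B.IsEfficient)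
    (H : UpdDAA.HashFamily B) (hH : H.IsEfficient) :
    (UpdDAA.brickellLi B H false).IsDAA ∧ (UpdDAA.brickellLiSplit B H).IsUpdateable :=
  ⟨⟨UpdDAA.brickellLi_isPPT hB hH, UpdDAA.brickellLi_isCorrect B H⟩,
    UpdDAA.brickellLiSplit_isUpdateable hB hH⟩
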